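/- Let $(M^{2n+1},\phi,\xi,\eta,g,\nabla,\nabla^*)$ be an almost cosymplectic statistical manifold. That is: $M$ is a smooth (Hausdorff) manifold of dimension $2n+1$; $(\phi,\xi,\eta,g)$ is an almost contact metric structure, i.e. $\phi$ is a $(1,1)$ tensor field, $\xi$ a vector field, $\eta$ a one-form and $g$ a Riemannian metric (all smooth) with $$\phi^2=-\mathrm{Id}+\eta\otimes\xi,\qquad \eta(\xi)=1,\qquad g(\phi X,\phi Y)=g(X,Y)-\eta(X)\eta(Y);$$ $d\eta=0$ and $d\Phi=0$, where $\Phi(X,Y)=g(\phi X,Y)$; and $\nabla,\nabla^*$ are smooth torsion free affine connections with $Zg(X,Y)=g(\nabla_ZX,Y)+g(X,\nabla^*_ZY)$ for all vector fields $X,Y,Z$. Let $\nabla^0$ be the Levi-Civita connection of $g$, and put $\mathcal K_XY=\nabla_XY-\nabla^0_XY$ and $\mathcal A^0X=-\nabla^0_X\xi$. Each leaf (maximal connected integral manifold) $L$ of the distribution $\eta=0$ carries the induced almost Hermitian structure $J\bar X=\phi\bar X$, $\langle\bar X,\bar Y\rangle=g(\bar X,\bar Y)$, and the connections $\nabla^L,\nabla^{*L}$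 obtained by orthogonally projecting $\nabla,\nabla^*$ to the leaf. The leaf is called a Kaehler statistical leaf if $(L,J,\langle\,,\rangle,\nabla^L,\nabla^{*L})$ is a Kaehler statistical manifold, i.e. $(L,J,\langle\,,\rangle)$ is almost Hermitian with closed fundamental form $\Omega(\bar X,\bar Y)=\langle J\bar X,\bar Y\rangle$ and vanishing Nijenhuis torsion of $J$, and $\nabla^L,\nabla^{*L}$ are smooth torsion free connections conjugate with respect to $\langle\,,\rangle$. Then all leaves of $\eta=0$ are Kaehler statistical leaves if and only if $$\nabla_X\phi Y-\phi\nabla^*_XY=g(\mathcal A^0X,\phi Y)\,\xi+\eta(Y)\,\phi\mathcal A^0X+\mathcal K_X\phi Y+\phi\mathcal K_XY$$ for all smooth vector fields $X,Y$ on $M$. -/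

import Mathlib

open Bundle
open scoped Manifold ContDiff Topology

universe u

namespace CosymplecticStatistical

noncomputable section

section Basics

variable {E : Type*} [NormedAddCommGroup E] [NormedSpace ℝ E]
  {H : Type*} [TopologicalSpace H] (I : ModelWithCorners ℝ E H)
  (M : Type*) [TopologicalSpace M] [ChartedSpace H M]

/-- Rough (not necessarily smooth) vector fields on `M`. -/
abbrev RoughField := ∀ x : M, TangentSpace I x

/-- Families of endomorphisms of the tangent spaces, not necessarily smooth. -/
abbrev RoughEndo := ∀ x : M, TangentSpace I x →L[ℝ] TangentSpace I x

/-- Families of linear forms on the tangent spaces, not necessarily smooth. -/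
abbrev RoughForm := ∀ x : M, TangentSpace I x →L[ℝ] ℝ

variable {M}

/-- `X` is a smooth vector field. -/
def IsSmoothField [IsManifold I ∞ M] (X : RoughField I M) : Prop :=
  ContMDiff I I.tangent ∞ (fun x => (⟨x, X x⟩ : TangentBundle I M))

/-- The family of linear forms `η` is a smooth one-form, that is, a smooth section
of the cotangent bundle. -/
def IsSmoothForm [IsManifold I ∞ M] (η : RoughForm I M) : Prop :=
  ContMDiff I (I.prod 𝓘(ℝ, E →L[ℝ] ℝ)) ∞
    (fun x => TotalSpace.mk' (E →L[ℝ] ℝ) (E := fun x : M => TangentSpace I x →L[ℝ] ℝ) x (η x))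

/-- The family of endomorphisms `φ` is a smooth `(1,1)` tensor field. -/
def IsSmoothEndo [IsManifold I ∞ M] (φ : RoughEndo I M) : Prop :=
  ContMDiff I (I.prod 𝓘(ℝ, E →L[ℝ] E)) ∞
    (fun x => TotalSpace.mk' (E →L[ℝ] E)
      (E := fun x : M => TangentSpace I x →L[ℝ] TangentSpace I x) x (φ x))

/-- The derivative `X f` of a function along a vector field. -/
def dirDeriv (X : RoughField I M) (f : M → ℝ) (x : M) : ℝ := mvfderiv I f x (X x)

/-- The one-form `η` is closed:
`X η(Y) - Y η(X) - η([X, Y]) = 0` for all smooth vector fields. -/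
def IsClosedOneForm [IsManifold I ∞ M] (η : RoughForm I M) : Prop :=
  ∀ X Y : RoughField I M, IsSmoothField I X → IsSmoothField I Y → ∀ x : M,
    dirDeriv I X (fun y => η y (Y y)) x - dirDeriv I Y (fun y => η y (X y)) x
      - η x (VectorField.mlieBracket I X Y x) = 0

/-- The two-form `Ω` is closed:
`X Ω(Y,Z) + Y Ω(Z,X) + Z Ω(X,Y) - Ω([X,Y],Z) - Ω([Y,Z],X) - Ω([Z,X],Y) = 0`
for all smooth vector fields. -/
def IsClosedTwoForm [IsManifold I ∞ M]
    (Ω : ∀ x : M, TangentSpace I x → TangentSpace I x → ℝ) : Prop :=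
  ∀ X Y Z : RoughField I M, IsSmoothField I X → IsSmoothField I Y → IsSmoothField I Z →
    ∀ x : M,
      dirDeriv I X (fun y => Ω y (Y y) (Z y)) x
        + dirDeriv I Y (fun y => Ω y (Z y) (X y)) x
        + dirDeriv I Z (fun y => Ω y (X y) (Y y)) x
        - Ω x (VectorField.mlieBracket I X Y x) (Z x)
        - Ω x (VectorField.mlieBracket I Y Z x) (X x)
        - Ω x (VectorField.mlieBracket I Z X x) (Y x) = 0

variable (M)

/-- Smooth Riemannian metrics on `M`. -/
abbrev Metric [IsManifold I ∞ M] :=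
  ContMDiffRiemannianMetric I ∞ E (fun x : M => TangentSpace I x)

/-- Affine connections on `M`; the value of `∇_X Y` at `x` is written `D Y x (X x)`. -/
abbrev AffineConnection [IsManifold I ∞ M] :=
  CovariantDerivative I E (fun x : M => TangentSpace I x)

end Basics

section Structures

variable {E : Type*} [NormedAddCommGroup E] [NormedSpace ℝ E] [FiniteDimensional ℝ E]
  {H : Type*} [TopologicalSpace H] {I : ModelWithCorners ℝ E H}
  {M : Type*} [TopologicalSpace M] [ChartedSpace H M] [IsManifold I ∞ M]

/-- The connections `D` and `D'` are conjugate with respect to `g`: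
`Z g(X,Y) = g(∇_Z X, Y) + g(X, ∇'_Z Y)`. -/
def AreConjugate (g : Metric I M) (D D' : AffineConnection I M) : Prop :=
  ∀ X Y Z : RoughField I M, IsSmoothField I X → IsSmoothField I Y → IsSmoothField I Z →
    ∀ x : M, dirDeriv I Z (fun y => g.inner y (X y) (Y y)) x
      = g.inner x (D X x (Z x)) (Y x) + g.inner x (X x) (D' Y x (Z x))

/-- `(M, g, D, D')` is a statistical manifold: `D` and `D'` are smooth torsion free affine
connections that are conjugate with respect to `g`. -/
structure IsStatistical (g : Metric I M) (D D' : AffineConnection I M) : Prop where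
  smooth : CovariantDerivative.ContMDiffCovariantDerivative D ∞
  smooth' : CovariantDerivative.ContMDiffCovariantDerivative D' ∞
  torsion_free : ∀ x, D.torsion x = 0
  torsion_free' : ∀ x, D'.torsion x = 0
  conjugate : AreConjugate g D D'

/-- `D₀` is the Levi-Civita connection of `g`: smooth, torsion free and metric. -/
structure IsLeviCivita (g : Metric I M) (D₀ : AffineConnection I M) : Prop where
  smooth : CovariantDerivative.ContMDiffCovariantDerivative D₀ ∞
  torsion_free : ∀ x, D₀.torsion x = 0
  metric : AreConjugate g D₀ D₀

variable (I M) in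
/-- An almost Hermitian structure `(J, g)`. -/
structure AlmostHermitian where
  J : RoughEndo I M
  g : Metric I M
  smooth_J : IsSmoothEndo I J
  J_sq : ∀ (x : M) (v : TangentSpace I x), J x (J x v) = -v
  compat : ∀ (x : M) (v w : TangentSpace I x), g.inner x (J x v) w = -g.inner x v (J x w)

/-- The almost Hermitian structure is Kaehler: the fundamental form `Ω(X,Y) = g(JX,Y)` is
closed and the Nijenhuis torsion of `J` vanishes. -/
structure AlmostHermitian.IsKaehler (S : AlmostHermitian I M) : Prop where
  closed : IsClosedTwoForm I (fun x v w => S.g.inner x (S.J x v) w)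
  nijenhuis : ∀ X Y : RoughField I M, IsSmoothField I X → IsSmoothField I Y → ∀ x : M,
    VectorField.mlieBracket I X Y x
      - VectorField.mlieBracket I (fun y => S.J y (X y)) (fun y => S.J y (Y y)) x
      + S.J x (VectorField.mlieBracket I X (fun y => S.J y (Y y)) x)
      + S.J x (VectorField.mlieBracket I (fun y => S.J y (X y)) Y x) = 0

/-- `(M, J, g, D, D')` is a Kaehler statistical manifold. -/
structure AlmostHermitian.IsKaehlerStatistical (S : AlmostHermitian I M)
    (D D' : AffineConnection I M) : Prop where
  kaehler : S.IsKaehler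
  statistical : IsStatistical S.g D D'

variable (I M) in
/-- An almost contact metric structure `(φ, ξ, η, g)`. -/
structure AlmostContactMetric where
  φ : RoughEndo I M
  ξ : RoughField I M
  η : RoughForm I M
  g : Metric I M
  smooth_φ : IsSmoothEndo I φ
  smooth_ξ : IsSmoothField I ξ
  smooth_η : IsSmoothForm I η
  φ_sq : ∀ (x : M) (v : TangentSpace I x), φ x (φ x v) = -v + η x v • ξ x
  η_ξ : ∀ x : M, η x (ξ x) = 1
  compat : ∀ (x : M) (v w : TangentSpace I x),
    g.inner x (φ x v) (φ x w) = g.inner x v w - η x v * η x w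

/-- The structure is almost cosymplectic: `η` and the fundamental form `Φ(X,Y) = g(φX,Y)`
are closed. -/
structure AlmostContactMetric.IsAlmostCosymplectic (S : AlmostContactMetric I M) : Prop where
  closed_η : IsClosedOneForm I S.η
  closed_Φ : IsClosedTwoForm I (fun x v w => S.g.inner x (S.φ x v) w)

/-- The endomorphism `A⁰ X = -∇⁰_X ξ`. -/
def AlmostContactMetric.shape (S : AlmostContactMetric I M) (D₀ : AffineConnection I M)
    (x : M) (v : TangentSpace I x) : TangentSpace I x := -(D₀ S.ξ x v)

/-- The difference tensor `K_X Y = ∇_X Y - ∇⁰_X Y`. -/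
def differenceTensor (D D₀ : AffineConnection I M) (X Y : RoughField I M) : RoughField I M :=
  fun x => D Y x (X x) - D₀ Y x (X x)

end Structures

section Leaves

variable {m : ℕ} (l : ℕ)
  {M : Type u} [TopologicalSpace M] [ChartedSpace (EuclideanSpace ℝ (Fin m)) M]
  {L : Type u} [TopologicalSpace L] [ChartedSpace (EuclideanSpace ℝ (Fin l)) L]

/-- `i : L → M` is a connected integral manifold of the distribution `η = 0`: a connected,
injectively immersed submanifold whose tangent spaces are the kernels of `η`. -/
structure IsIntegralManifold (η : RoughForm (𝓡 m) M) (i : L → M) : Prop where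
  connected : ConnectedSpace L
  smooth : ContMDiff (𝓡 l) (𝓡 m) ∞ i
  injective : Function.Injective i
  immersion : ∀ p : L, Function.Injective (mfderiv (𝓡 l) (𝓡 m) i p)
  tangent : ∀ (p : L) (w : TangentSpace (𝓡 m) (i p)),
    (∃ v : TangentSpace (𝓡 l) p, mfderiv (𝓡 l) (𝓡 m) i p v = w) ↔ η (i p) w = 0

/-- `i : L → M` is a leaf of the distribution `η = 0`: a maximal connected integral manifold. -/
structure IsLeaf (η : RoughForm (𝓡 m) M) (i : L → M) : Prop where
  integral : IsIntegralManifold l η i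
  maximal : ∀ (L' : Type u) [TopologicalSpace L'] [ChartedSpace (EuclideanSpace ℝ (Fin l)) L']
    [IsManifold (𝓡 l) ∞ L'] (i' : L' → M), IsIntegralManifold l η i' →
      Set.range i ⊆ Set.range i' → Set.range i' ⊆ Set.range i

variable [IsManifold (𝓡 m) ∞ M] [IsManifold (𝓡 l) ∞ L]

/-- The connection `DL` on `L` is induced by the connection `D` on `M`: if the smooth vector
field `Z` on `M` extends the vector field `Y` on `L` near `p`, then `DL_v Y` is the component
of `D_v Z` tangent to the leaf, i.e. its orthogonal projection `w ↦ w - η(w) ξ`. -/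
def IsInducedConnection (S : AlmostContactMetric (𝓡 m) M) (i : L → M)
    (D : AffineConnection (𝓡 m) M) (DL : AffineConnection (𝓡 l) L) : Prop :=
  ∀ (Y : RoughField (𝓡 l) L) (Z : RoughField (𝓡 m) M),
    IsSmoothField (𝓡 l) Y → IsSmoothField (𝓡 m) Z → ∀ p : L,
      (∀ᶠ q in 𝓝 p, mfderiv (𝓡 l) (𝓡 m) i q (Y q) = Z (i q)) →
      ∀ v : TangentSpace (𝓡 l) p,
        mfderiv (𝓡 l) (𝓡 m) i p (DL Y p v)
          = D Z (i p) (mfderiv (𝓡 l) (𝓡 m) i p v)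
            - S.η (i p) (D Z (i p) (mfderiv (𝓡 l) (𝓡 m) i p v)) • S.ξ (i p)

/-- The leaf `i : L → M`, with `J X = φ X`, `⟨X, Y⟩ = g(X, Y)` and the connections induced by
`D` and `D'`, is a Kaehler statistical manifold. -/
def IsKaehlerStatisticalLeaf (S : AlmostContactMetric (𝓡 m) M)
    (D D' : AffineConnection (𝓡 m) M) (i : L → M) : Prop :=
  ∃ (T : AlmostHermitian (𝓡 l) L) (DL DL' : AffineConnection (𝓡 l) L),
    (∀ (p : L) (v : TangentSpace (𝓡 l) p),
      mfderiv (𝓡 l) (𝓡 m) i p (T.J p v) = S.φ (i p) (mfderiv (𝓡 l) (𝓡 m) i p v)) ∧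
    (∀ (p : L) (v w : TangentSpace (𝓡 l) p),
      T.g.inner p v w
        = S.g.inner (i p) (mfderiv (𝓡 l) (𝓡 m) i p v) (mfderiv (𝓡 l) (𝓡 m) i p w)) ∧
    IsInducedConnection l S i D DL ∧ IsInducedConnection l S i D' DL' ∧
    T.IsKaehlerStatistical DL DL'

end Leaves

/-- All leaves of the distribution `η = 0` are Kaehler statistical leaves. -/
def HasKaehlerStatisticalLeaves {n : ℕ} {M : Type u} [TopologicalSpace M]
    [ChartedSpace (EuclideanSpace ℝ (Fin (2 * n + 1))) M] [IsManifold (𝓡 (2 * n + 1)) ∞ M]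
    (S : AlmostContactMetric (𝓡 (2 * n + 1)) M)
    (D D' : AffineConnection (𝓡 (2 * n + 1)) M) : Prop :=
  ∀ (L : Type u) [TopologicalSpace L] [ChartedSpace (EuclideanSpace ℝ (Fin (2 * n))) L]
    [IsManifold (𝓡 (2 * n)) ∞ L] (i : L → M), IsLeaf (2 * n) S.η i →
    IsKaehlerStatisticalLeaf (2 * n) S D D' i

end

end CosymplecticStatistical

namespace CosymplecticStatistical

section LinearAlgebra

variable {V : Type*} [AddCommGroup V] [Module ℝ V] [TopologicalSpace V]

/-- An almost contact metric structure on a vector space. -/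
structure IsAlmostContactVectorSpace (g : V →L[ℝ] V →L[ℝ] ℝ) (φ : V →L[ℝ] V) (ξ : V)
    (η : V →L[ℝ] ℝ) : Prop where
  symm : ∀ v w, g v w = g w v
  pos : ∀ v, v ≠ 0 → 0 < g v v
  φ_sq : ∀ v, φ (φ v) = -v + η v • ξ
  η_ξ : η ξ = 1
  compat : ∀ v w, g (φ v) (φ w) = g v w - η v * η w

namespace IsAlmostContactVectorSpace

variable {g : V →L[ℝ] V →L[ℝ] ℝ} {φ : V →L[ℝ] V} {ξ : V} {η : V →L[ℝ] ℝ}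

theorem φ_ξ (h : IsAlmostContactVectorSpace g φ ξ η) : φ ξ = 0 := by
  have h0 : φ (φ ξ) = 0 := by rw [h.φ_sq, h.η_ξ]; simp
  have h1 : φ ξ = η (φ ξ) • ξ := by
    have := h.φ_sq (φ ξ)
    rw [h0, map_zero] at this
    exact (neg_add_eq_zero.mp this.symm)
  have h2 : η (φ ξ) * η (φ ξ) = 0 := by
    have : φ (φ ξ) = (η (φ ξ) * η (φ ξ)) • ξ := by
      conv_lhs => rw [h1, map_smul, h1]
      rw [smul_smul]
      simp [h.η_ξ]
    have h3 := congrArg η (this.symm.trans h0)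
    simpa [h.η_ξ] using h3
  rw [h1, mul_self_eq_zero.mp h2, zero_smul]

theorem η_φ (h : IsAlmostContactVectorSpace g φ ξ η) (v : V) : η (φ v) = 0 := by
  have h1 := h.φ_sq (φ v)
  rw [h.φ_sq v, map_add, map_neg, map_smul, h.φ_ξ, smul_zero] at h1
  have h2 : η (φ v) • ξ = 0 := (left_eq_add (a := -φ v)).mp (by rw [← h1, add_zero])
  simpa [h.η_ξ] using congrArg η h2

theorem g_ξ (h : IsAlmostContactVectorSpace g φ ξ η) (v : V) : g v ξ = η v := by
  have := h.compat v ξ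
  rw [h.φ_ξ, map_zero, h.η_ξ] at this
  linarith

theorem φ_skew (h : IsAlmostContactVectorSpace g φ ξ η) (v w : V) : g (φ v) w = -g v (φ w) := by
  have := h.compat v (φ w)
  rw [h.φ_sq, h.η_φ] at this
  simp only [map_add, map_neg, map_smul, h.g_ξ, h.η_φ, smul_eq_mul] at this
  linarith

theorem eq_of_forall_g_eq (h : IsAlmostContactVectorSpace g φ ξ η) {a b : V}
    (hab : ∀ w, g a w = g b w) : a = b := by
  by_contra hne
  have h1 := h.pos (a - b) (sub_ne_zero.mpr hne)
  have h2 : g (a - b) (a - b) = 0 := by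
    rw [map_sub g, sub_apply, hab, sub_self]
  exact h1.ne' h2

end IsAlmostContactVectorSpace

variable [IsTopologicalAddGroup V] [ContinuousSMul ℝ V]

/-- The algebraic relations between the endomorphism `A v = -∇⁰_v ξ` and the tensor
`P v u = (∇⁰_u φ) v` on a tangent space of an almost cosymplectic manifold. -/
structure IsCosymplecticJet (g : V →L[ℝ] V →L[ℝ] ℝ) (φ : V →L[ℝ] V) (ξ : V)
    (η : V →L[ℝ] ℝ) (A : V →L[ℝ] V) (P : V →L[ℝ] V →L[ℝ] V) : Prop
    extends IsAlmostContactVectorSpace g φ ξ η where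
  A_symm : ∀ v w, g (A v) w = g v (A w)
  A_horizontal : ∀ v, g (A v) ξ = 0
  P_skew : ∀ u v w, g (P v u) w = -g v (P w u)
  P_cyclic : ∀ u v w, g (P v u) w + g (P w v) u + g (P u w) v = 0
  P_φ : ∀ u v, P (φ v) u + φ (P v u) = -g (A u) v • ξ - η v • A u

/-- The Nijenhuis torsion of `φ` on horizontal vectors, in terms of `P v u = (∇⁰_u φ) v`. -/
noncomputable def nijenhuisTensor (φ : V →L[ℝ] V) (P : V →L[ℝ] V →L[ℝ] V) (v w : V) : V :=
  -P w (φ v) + P v (φ w) + φ (P w v) - φ (P v w)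

namespace IsCosymplecticJet

variable {g : V →L[ℝ] V →L[ℝ] ℝ} {φ : V →L[ℝ] V} {ξ : V} {η : V →L[ℝ] ℝ}
  {A : V →L[ℝ] V} {P : V →L[ℝ] V →L[ℝ] V}

theorem P_ξ (h : IsCosymplecticJet g φ ξ η A P) (u : V) : P ξ u = φ (A u) := by
  have h1 := congrArg φ (h.P_φ u ξ)
  have h2 : η (P ξ u) = 0 := by
    have h3 := h.P_skew u ξ ξ
    rw [h.symm ξ] at h3
    rw [← h.g_ξ]
    linarith
  rw [h.φ_ξ] at h1
  simp only [map_zero, zero_apply, zero_add, h.φ_sq, h2, h.A_horizontal,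
    h.η_ξ, zero_smul, add_zero, neg_zero, zero_sub, one_smul, map_neg] at h1
  exact neg_inj.mp h1

theorem g_P_φ (h : IsCosymplecticJet g φ ξ η A P) (u : V) {v w : V} (hv : η v = 0) (hw : η w = 0) :
    g (P (φ v) u) w = g (P v u) (φ w) := by
  have h1 := congrArg (fun z => g z w) (h.P_φ u v)
  simp only [map_add, map_sub, map_smul, add_apply,
    sub_apply, smul_apply, smul_eq_mul, hv, h.symm ξ w,
    h.g_ξ, hw, h.φ_skew] at h1
  linarith

theorem φ_φ (h : IsCosymplecticJet g φ ξ η A P) {v : V} (hv : η v = 0) : φ (φ v) = -v := by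
  rw [h.φ_sq, hv]
  simp

theorem P_ξ_direction (h : IsCosymplecticJet g φ ξ η A P) {v w : V} (hv : η v = 0)
    (hw : η w = 0) : g (P v ξ) w = 0 := by
  have key : ∀ v w : V, η v = 0 → η w = 0 → g (P v ξ) w = g (A w) (φ v) - g (A v) (φ w) := by
    intro v w hv hw
    have h1 := h.P_cyclic ξ v w
    have h2 := h.P_skew v w ξ
    rw [h.P_ξ] at h1 h2
    have h3 : g (φ (A w)) v = -g (A w) (φ v) := h.φ_skew _ _
    have h4 : g w (φ (A v)) = -g (A v) (φ w) := by rw [h.symm, h.φ_skew]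
    linarith
  have h1 := key v w hv hw
  have h2 := key (φ v) (φ w) (h.η_φ v) (h.η_φ w)
  rw [h.g_P_φ ξ hv (h.η_φ w), h.φ_φ hw, h.φ_φ hv, h.A_symm (φ w), h.A_symm (φ v)] at h2
  simp only [map_neg] at h2
  rw [h.symm (φ w), h.symm (φ v)] at h2
  linarith

theorem P_horizontal (h : IsCosymplecticJet g φ ξ η A P)
    (hN : ∀ v w, η v = 0 → η w = 0 → nijenhuisTensor φ P v w = 0) {u v w : V}
    (hu : η u = 0) (hv : η v = 0) (hw : η w = 0) : g (P v u) w = 0 := by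
  have key : ∀ x v w : V, η x = 0 → η v = 0 → η w = 0 → g (P (φ v) (φ x)) w = 0 := by
    intro x v w hx hv hw
    have h0 := congrArg (fun z => g z (φ x)) (hN v w hv hw)
    simp only [nijenhuisTensor, map_add, map_sub, map_neg, add_apply,
      sub_apply, neg_apply, h.compat, hx, map_zero,
      zero_apply] at h0
    have c1 := h.P_cyclic (φ v) w (φ x)
    have c2 := h.P_cyclic (φ w) v (φ x)
    have e1 : g (P (φ x) w) (φ v) = g (P v w) x := by
      rw [h.g_P_φ w hx (h.η_φ v), h.φ_φ hv, map_neg]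
      have := h.P_skew w x v
      rw [h.symm x] at this
      linarith
    have e2 : g (P (φ x) v) (φ w) = g (P w v) x := by
      rw [h.g_P_φ v hx (h.η_φ w), h.φ_φ hw, map_neg]
      have := h.P_skew v x w
      rw [h.symm x] at this
      linarith
    have e3 : g (P (φ w) (φ x)) v = -g (P (φ v) (φ x)) w := by
      rw [h.g_P_φ _ hw hv, h.P_skew, h.symm]
    linarith
  have h1 := key (φ u) (φ v) w (h.η_φ u) (h.η_φ v) hw
  rw [h.φ_φ hu, h.φ_φ hv] at h1
  simpa using h1

/-- If the Nijenhuis torsion vanishes on horizontal vectors, then `∇⁰φ` is determined by `A`. -/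
theorem P_eq_of_nijenhuisTensor_eq_zero (h : IsCosymplecticJet g φ ξ η A P)
    (hN : ∀ v w, η v = 0 → η w = 0 → nijenhuisTensor φ P v w = 0) (u v : V) :
    P v u = g (A u) (φ v) • ξ + η v • φ (A u) := by
  have hor : ∀ z : V, η (z - η z • ξ) = 0 := fun z => by simp [h.η_ξ]
  have dec : ∀ z : V, z = (z - η z • ξ) + η z • ξ := fun z => by abel
  have main : ∀ u v w : V, η v = 0 → η w = 0 → g (P v u) w = 0 := by
    intro u v w hv hw
    rw [dec u, map_add, map_smul]
    simp only [map_add, map_smul, add_apply, smul_apply,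
      h.P_horizontal hN (hor u) hv hw, h.P_ξ_direction hv hw, smul_zero, add_zero]
  have main' : ∀ u v : V, η v = 0 → P v u = g (A u) (φ v) • ξ := by
    intro u v hv
    refine h.eq_of_forall_g_eq fun w => ?_
    rw [dec w, map_add, map_smul, main u v _ hv (hor w), h.P_skew u v ξ, h.P_ξ]
    simp only [map_add, map_smul, smul_apply, map_sub, smul_eq_mul,
      h.symm ξ w, h.g_ξ, h.η_ξ, h.symm v, h.φ_skew]
    ring
  conv_lhs => rw [dec v, map_add, map_smul, add_apply,
    smul_apply, main' u _ (hor v), h.P_ξ]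
  simp [h.φ_ξ]

theorem nijenhuisTensor_eq_zero (h : IsCosymplecticJet g φ ξ η A P)
    (hP : ∀ u v, P v u = g (A u) (φ v) • ξ + η v • φ (A u)) {v w : V}
    (hv : η v = 0) (hw : η w = 0) : nijenhuisTensor φ P v w = 0 := by
  simp only [nijenhuisTensor, hP, hv, hw, zero_smul, add_zero, map_smul, h.φ_ξ, smul_zero,
    sub_zero]
  rw [h.A_symm (φ v), h.symm (φ v)]
  simp

end IsCosymplecticJet

end LinearAlgebra

section SmoothSections

variable {E : Type*} [NormedAddCommGroup E] [NormedSpace ℝ E]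
  {H : Type*} [TopologicalSpace H] {I : ModelWithCorners ℝ E H}
  {M : Type*} [TopologicalSpace M] [ChartedSpace H M] [IsManifold I ∞ M]

theorem IsSmoothField.mdifferentiableAt {X : RoughField I M} (hX : IsSmoothField I X) (x : M) :
    MDiffAt (T% X) x :=
  (hX x).mdifferentiableAt (by simp)

theorem IsSmoothEndo.apply {φ : RoughEndo I M} (hφ : IsSmoothEndo I φ) {X : RoughField I M}
    (hX : IsSmoothField I X) : IsSmoothField I (fun y => φ y (X y)) :=
  ContMDiff.clm_bundle_apply hφ hX

theorem IsSmoothEndo.mdifferentiableAt_apply {φ : RoughEndo I M} (hφ : IsSmoothEndo I φ)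
    {X : RoughField I M} {x : M} (hX : MDiffAt (T% X) x) :
    MDiffAt (T% (fun y => φ y (X y))) x :=
  MDifferentiableAt.clm_bundle_apply ((hφ x).mdifferentiableAt (by simp)) hX

theorem IsSmoothForm.contMDiffAt_apply {η : RoughForm I M} (hη : IsSmoothForm I η)
    {X : RoughField I M} {x : M} (hX : ContMDiffAt I I.tangent ∞ (T% X) x) :
    ContMDiffAt I 𝓘(ℝ) ∞ (fun y => η y (X y)) x := by
  have h : ContMDiffAt I (I.prod 𝓘(ℝ)) ∞
      (fun m ↦ TotalSpace.mk' ℝ (E := Bundle.Trivial M ℝ) m (η m (X m))) x :=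
    ContMDiffAt.clm_bundle_apply (F₁ := E) (E₁ := fun x : M => TangentSpace I x) (hη x) hX
  simp only [contMDiffAt_totalSpace] at h
  exact h.2

theorem contMDiffAt_metric (g : Metric I M) {X Y : RoughField I M} {x : M}
    (hX : ContMDiffAt I I.tangent ∞ (T% X) x) (hY : ContMDiffAt I I.tangent ∞ (T% Y) x) :
    ContMDiffAt I 𝓘(ℝ) ∞ (fun y => g.inner y (X y) (Y y)) x := by
  have h : ContMDiffAt I (I.prod 𝓘(ℝ)) ∞
      (fun m ↦ TotalSpace.mk' ℝ (E := Bundle.Trivial M ℝ) m (g.inner m (X m) (Y m))) x :=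
    ContMDiffAt.clm_bundle_apply₂ (F₁ := E) (F₂ := E) (E₁ := fun x : M => TangentSpace I x)
      (E₂ := fun x : M => TangentSpace I x) (g.contMDiff x) hX hY
  simp only [contMDiffAt_totalSpace] at h
  exact h.2

end SmoothSections

section Extension

variable {E : Type*} [NormedAddCommGroup E] [NormedSpace ℝ E] [FiniteDimensional ℝ E]
  {H : Type*} [TopologicalSpace H] {I : ModelWithCorners ℝ E H}
  {M : Type*} [TopologicalSpace M] [T2Space M] [ChartedSpace H M] [IsManifold I ∞ M]

/-- A bump function supported in a given neighbourhood. -/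
theorem exists_smoothBump_tsupport_subset {x : M} {s : Set M} (hs : s ∈ 𝓝 x) :
    ∃ f : M → ℝ, ContMDiff I 𝓘(ℝ) ∞ f ∧ tsupport f ⊆ s ∧ ∀ᶠ y in 𝓝 x, f y = 1 := by
  obtain ⟨f, -, hf⟩ := (SmoothBumpFunction.nhds_basis_tsupport (I := I) x).mem_iff.1 hs
  exact ⟨f, f.contMDiff, hf, f.eventuallyEq_one⟩

/-- A vector field that is smooth near `x` agrees near `x` with a smooth vector field. -/
theorem exists_isSmoothField_eventuallyEq {X : RoughField I M} {x : M}
    (hX : ∀ᶠ y in 𝓝 x, ContMDiffAt I I.tangent ∞ (T% X) y) :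
    ∃ X' : RoughField I M, IsSmoothField I X' ∧ ∀ᶠ y in 𝓝 x, X' y = X y := by
  obtain ⟨U, hUX, hU, hxU⟩ := eventually_nhds_iff.1 hX
  obtain ⟨f, hf, hfU, hf1⟩ := exists_smoothBump_tsupport_subset (I := I) (hU.mem_nhds hxU)
  refine ⟨f • X, ContMDiffOn.smul_section_of_tsupport hf.contMDiffOn hU hfU
    fun y hy => (hUX y hy).contMDiffWithinAt, ?_⟩
  filter_upwards [hf1] with y hy
  simp [hy]

/-- Every tangent vector extends to a smooth vector field. -/
theorem exists_isSmoothField_apply_eq {x : M} (v : TangentSpace I x) :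
    ∃ X : RoughField I M, IsSmoothField I X ∧ X x = v := by
  obtain ⟨s, hs, hsm⟩ := FiberBundle.exists_contMDiffOn_extend (k := ∞) I E v
  obtain ⟨X, hX, hXv⟩ := exists_isSmoothField_eventuallyEq (I := I)
    (X := FiberBundle.extend E v) (x := x) (by
      filter_upwards [eventually_mem_nhds_iff.2 hs] with y hy
      exact (hsm y (mem_of_mem_nhds hy)).contMDiffAt hy)
  exact ⟨X, hX, by simpa using hXv.self_of_nhds⟩

end Extension

section Connections

variable {E : Type*} [NormedAddCommGroup E] [NormedSpace ℝ E] [FiniteDimensional ℝ E]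
  {H : Type*} [TopologicalSpace H] {I : ModelWithCorners ℝ E H}
  {M : Type*} [TopologicalSpace M] [ChartedSpace H M] [IsManifold I ∞ M]

theorem mlieBracket_eq_of_torsion_eq_zero {D : AffineConnection I M} {x : M}
    (hD : D.torsion x = 0) {X Y : RoughField I M} (hX : IsSmoothField I X)
    (hY : IsSmoothField I Y) :
    VectorField.mlieBracket I X Y x = D Y x (X x) - D X x (Y x) := by
  have h := D.torsion_apply (hX.mdifferentiableAt x) (hY.mdifferentiableAt x)
  rw [hD] at h
  exact (sub_eq_zero.1 h.symm).symm

/-- The covariant derivative of a smooth endomorphism field is a tensor. -/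
theorem exists_covariantDerivative_endo (D : AffineConnection I M) {φ : RoughEndo I M}
    (hφ : IsSmoothEndo I φ) (x : M) :
    ∃ P : TangentSpace I x →L[ℝ] TangentSpace I x →L[ℝ] TangentSpace I x,
      ∀ (Y : RoughField I M), MDiffAt (T% Y) x → ∀ u : TangentSpace I x,
        P (Y x) u = D (fun y => φ y (Y y)) x u - φ x (D Y x u) := by
  have hT : TensorialAt I E (fun Y : RoughField I M =>
      D (fun y => φ y (Y y)) x - (φ x).comp (D Y x)) x := by
    constructor
    · intro f σ hf hσ
      have h1 : (fun y => φ y ((f • σ) y)) = f • fun y => φ y (σ y) := by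
        ext y; simp
      rw [h1, D.isCovariantDerivativeOnUniv.leibniz (hφ.mdifferentiableAt_apply hσ) hf,
        D.isCovariantDerivativeOnUniv.leibniz hσ hf]
      ext u
      simp [smul_sub]
    · intro σ σ' hσ hσ'
      have h1 : (fun y => φ y ((σ + σ') y)) = (fun y => φ y (σ y)) + fun y => φ y (σ' y) := by
        ext y; simp
      rw [h1, D.isCovariantDerivativeOnUniv.add (hφ.mdifferentiableAt_apply hσ)
        (hφ.mdifferentiableAt_apply hσ'), D.isCovariantDerivativeOnUniv.add hσ hσ']
      ext u
      simp
      abel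
  refine ⟨TensorialAt.mkHom _ x hT, fun Y hY u => ?_⟩
  rw [TensorialAt.mkHom_apply hT hY]
  rfl

end Connections

section Cosymplectic

variable {E : Type*} [NormedAddCommGroup E] [NormedSpace ℝ E]
  {H : Type*} [TopologicalSpace H] {I : ModelWithCorners ℝ E H}
  {M : Type*} [TopologicalSpace M] [ChartedSpace H M] [IsManifold I ∞ M]

theorem AlmostContactMetric.isAlmostContactVectorSpace (S : AlmostContactMetric I M) (x : M) :
    IsAlmostContactVectorSpace (S.g.inner x) (S.φ x) (S.ξ x) (S.η x) where
  symm := S.g.symm x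
  pos := S.g.pos x
  φ_sq := S.φ_sq x
  η_ξ := S.η_ξ x
  compat := S.compat x

variable [FiniteDimensional ℝ E] [T2Space M]

/-- In a statistical manifold, `∇* - ∇⁰ = -(∇ - ∇⁰)`. -/
theorem IsStatistical.add_eq {g : Metric I M} {D D' D₀ : AffineConnection I M}
    (hD : IsStatistical g D D') (hD₀ : IsLeviCivita g D₀) {X Y : RoughField I M}
    (hX : IsSmoothField I X) (hY : IsSmoothField I Y) (x : M) :
    D Y x (X x) + D' Y x (X x) = D₀ Y x (X x) + D₀ Y x (X x) := by
  have K : ∀ X Y Z : RoughField I M, IsSmoothField I X → IsSmoothField I Y → IsSmoothField I Z →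
      g.inner x (D X x (Z x)) (Y x) + g.inner x (D' Y x (Z x)) (X x)
        = g.inner x (D₀ X x (Z x)) (Y x) + g.inner x (D₀ Y x (Z x)) (X x) := by
    intro X Y Z hX hY hZ
    rw [g.symm x _ (X x), g.symm x _ (X x), ← hD.conjugate X Y Z hX hY hZ x,
      hD₀.metric X Y Z hX hY hZ x]
  have T : ∀ D₁ : AffineConnection I M, D₁.torsion x = 0 → ∀ X Y Z : RoughField I M,
      IsSmoothField I X → IsSmoothField I Y →
      g.inner x (D₁ X x (Y x)) (Z x) - g.inner x (D₁ Y x (X x)) (Z x)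
        = g.inner x (D₀ X x (Y x)) (Z x) - g.inner x (D₀ Y x (X x)) (Z x) := by
    intro D₁ hD₁ X Y Z hX hY
    rw [← sub_apply, ← sub_apply, ← map_sub, ← map_sub,
      ← mlieBracket_eq_of_torsion_eq_zero hD₁ hY hX,
      ← mlieBracket_eq_of_torsion_eq_zero (hD₀.torsion_free x) hY hX]
  have nondeg : ∀ a b : TangentSpace I x, (∀ w, g.inner x a w = g.inner x b w) → a = b := by
    intro a b hab
    by_contra hne
    refine (g.pos x (a - b) (sub_ne_zero.mpr hne)).ne' ?_
    rw [map_sub (g.inner x), sub_apply, hab, sub_self]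
  refine nondeg _ _ fun w => ?_
  obtain ⟨W, hW, rfl⟩ := exists_isSmoothField_apply_eq w
  simp only [map_add, add_apply]
  linarith [K X Y W hX hY hW, K Y X W hY hX hW, K X W Y hX hW hY, K W X Y hW hX hY,
    K Y W X hY hW hX, K W Y X hW hY hX, T D (hD.torsion_free x) X Y W hX hY,
    T D (hD.torsion_free x) Y W X hY hW, T D (hD.torsion_free x) X W Y hX hW,
    T D' (hD.torsion_free' x) X Y W hX hY, T D' (hD.torsion_free' x) Y W X hY hW,
    T D' (hD.torsion_free' x) X W Y hX hW]

/-- The first order data of an almost cosymplectic structure at a point. -/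
theorem AlmostContactMetric.exists_isCosymplecticJet (S : AlmostContactMetric I M)
    (hS : S.IsAlmostCosymplectic) {D₀ : AffineConnection I M} (hD₀ : IsLeviCivita S.g D₀)
    (x : M) :
    ∃ P : TangentSpace I x →L[ℝ] TangentSpace I x →L[ℝ] TangentSpace I x,
      IsCosymplecticJet (S.g.inner x) (S.φ x) (S.ξ x) (S.η x) (-(D₀ S.ξ x)) P ∧
      ∀ (Y : RoughField I M), MDiffAt (T% Y) x → ∀ u : TangentSpace I x,
        P (Y x) u = D₀ (fun y => S.φ y (Y y)) x u - S.φ x (D₀ Y x u) := by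
  obtain ⟨P, hP⟩ := exists_covariantDerivative_endo D₀ S.smooth_φ x
  refine ⟨P, ?_, hP⟩
  have hPs : ∀ Y : RoughField I M, IsSmoothField I Y → ∀ u : TangentSpace I x,
      P (Y x) u = D₀ (fun y => S.φ y (Y y)) x u - S.φ x (D₀ Y x u) :=
    fun Y hY => hP Y (hY.mdifferentiableAt x)
  have hx := S.isAlmostContactVectorSpace x
  have hφ : ∀ {X : RoughField I M}, IsSmoothField I X → IsSmoothField I (fun y => S.φ y (X y)) :=
    fun hX => S.smooth_φ.apply hX
  have hη : ∀ {X : RoughField I M}, IsSmoothField I X → ∀ u : TangentSpace I x,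
      mvfderiv I (fun y => S.η y (X y)) x u
        = S.η x (D₀ X x u) + S.g.inner x (X x) (D₀ S.ξ x u) := by
    intro X hX u
    obtain ⟨U, hU, rfl⟩ := exists_isSmoothField_apply_eq u
    have h := hD₀.metric X S.ξ U hX S.smooth_ξ hU x
    rw [hx.g_ξ, dirDeriv] at h
    rw [← h]
    congr 2
    ext y
    exact ((S.isAlmostContactVectorSpace y).g_ξ _).symm
  have hbr : ∀ {X Y : RoughField I M}, IsSmoothField I X → IsSmoothField I Y →
      VectorField.mlieBracket I X Y x = D₀ Y x (X x) - D₀ X x (Y x) :=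
    fun hX hY => mlieBracket_eq_of_torsion_eq_zero (hD₀.torsion_free x) hX hY
  refine ⟨hx, ?_, ?_, ?_, ?_, ?_⟩
  · intro v w
    obtain ⟨X, hX, rfl⟩ := exists_isSmoothField_apply_eq v
    obtain ⟨Y, hY, rfl⟩ := exists_isSmoothField_apply_eq w
    have h := hS.closed_η X Y hX hY x
    rw [dirDeriv, dirDeriv, hη hY, hη hX, hbr hX hY, map_sub] at h
    simp only [neg_apply, map_neg]
    rw [hx.symm _ (Y x)]
    linarith
  · intro v
    obtain ⟨X, hX, rfl⟩ := exists_isSmoothField_apply_eq v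
    have h := hη S.smooth_ξ (X x)
    have h1 : (fun y => S.η y (S.ξ y)) = fun _ => (1 : ℝ) := funext S.η_ξ
    rw [h1, mvfderiv_const, hx.symm, hx.g_ξ] at h
    simp only [neg_apply, map_neg, hx.g_ξ]
    have h2 : (0 : ℝ) = S.η x (D₀ S.ξ x (X x)) + S.η x (D₀ S.ξ x (X x)) := h
    linarith
  · intro u v w
    obtain ⟨X, hX, rfl⟩ := exists_isSmoothField_apply_eq u
    obtain ⟨Y, hY, rfl⟩ := exists_isSmoothField_apply_eq v
    obtain ⟨Z, hZ, rfl⟩ := exists_isSmoothField_apply_eq w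
    have h1 := hD₀.metric _ Z X (hφ hY) hZ hX x
    have h2 := hD₀.metric Y _ X hY (hφ hZ) hX x
    have h3 : (fun y => S.g.inner y (S.φ y (Y y)) (Z y))
        = -fun y => S.g.inner y (Y y) (S.φ y (Z y)) :=
      funext fun y => (S.isAlmostContactVectorSpace y).φ_skew _ _
    rw [h3, dirDeriv, mvfderiv_neg] at h1
    rw [dirDeriv] at h2
    have h4 := congrArg Neg.neg h2
    rw [← neg_apply] at h4
    have h5 := h1.symm.trans h4
    rw [hPs Y hY, hPs Z hZ, map_sub, map_sub, sub_apply, hx.φ_skew]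
    rw [hx.φ_skew] at h5
    linarith
  · intro u v w
    obtain ⟨X, hX, rfl⟩ := exists_isSmoothField_apply_eq u
    obtain ⟨Y, hY, rfl⟩ := exists_isSmoothField_apply_eq v
    obtain ⟨Z, hZ, rfl⟩ := exists_isSmoothField_apply_eq w
    have h := hS.closed_Φ X Y Z hX hY hZ x
    rw [hD₀.metric _ Z X (hφ hY) hZ hX x, hD₀.metric _ X Y (hφ hZ) hX hY x,
      hD₀.metric _ Y Z (hφ hX) hY hZ x, hbr hX hY, hbr hY hZ, hbr hZ hX] at h
    rw [hPs X hX, hPs Y hY, hPs Z hZ]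
    simp only [map_sub, sub_apply, hx.φ_skew] at h ⊢
    have e : ∀ a b, S.g.inner x a (S.φ x b) = -S.g.inner x b (S.φ x a) := fun a b => by
      rw [hx.symm, hx.φ_skew]
    rw [e (Y x), e (Z x), e (X x)] at h
    linarith
  · intro u v
    obtain ⟨Y, hY, rfl⟩ := exists_isSmoothField_apply_eq v
    have h1 : (fun y => S.φ y (S.φ y (Y y))) = (-1 : ℝ) • Y + (fun y => S.η y (Y y)) • S.ξ := by
      ext y
      simp [S.φ_sq]
    have hηY : MDiffAt (fun y => S.η y (Y y)) x :=
      (S.smooth_η.contMDiffAt_apply (hY x)).mdifferentiableAt (by simp)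
    have hξ := S.smooth_ξ.mdifferentiableAt x
    have hYx := hY.mdifferentiableAt x
    have hcov := D₀.isCovariantDerivativeOnUniv
    rw [hPs _ (hφ hY), hPs Y hY, h1,
      hcov.add (MDifferentiableAt.smul_const_section (a := (-1 : ℝ)) hYx) (hηY.smul_section hξ),
      hcov.smul_const _ hYx, hcov.leibniz hξ hηY]
    simp only [add_apply, smul_apply, ContinuousLinearMap.smulRight_apply, map_sub, S.φ_sq, hη hY,
      neg_apply, map_neg]
    rw [hx.symm (Y x)]
    module

/-- The Nijenhuis torsion of `φ` evaluated on two vector fields, up to a vertical term. -/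
noncomputable def nijenhuisBracket (φ : RoughEndo I M) (X Y : RoughField I M) :
    RoughField I M := fun x =>
  VectorField.mlieBracket I X Y x
    - VectorField.mlieBracket I (fun y => φ y (X y)) (fun y => φ y (Y y)) x
    + φ x (VectorField.mlieBracket I X (fun y => φ y (Y y)) x)
    + φ x (VectorField.mlieBracket I (fun y => φ y (X y)) Y x)

omit [T2Space M] in
theorem AlmostContactMetric.nijenhuisBracket_eq (S : AlmostContactMetric I M)
    {D₀ : AffineConnection I M} (hD₀ : IsLeviCivita S.g D₀) {x : M}
    {P : TangentSpace I x →L[ℝ] TangentSpace I x →L[ℝ] TangentSpace I x}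
    (hP : ∀ (Y : RoughField I M), MDiffAt (T% Y) x → ∀ u : TangentSpace I x,
        P (Y x) u = D₀ (fun y => S.φ y (Y y)) x u - S.φ x (D₀ Y x u))
    {X Y : RoughField I M} (hX : IsSmoothField I X) (hY : IsSmoothField I Y) :
    nijenhuisBracket S.φ X Y x = S.η x (VectorField.mlieBracket I X Y x) • S.ξ x
      + nijenhuisTensor (S.φ x) P (X x) (Y x) := by
  have h0 := hD₀.torsion_free x
  have hφX := S.smooth_φ.apply hX
  have hφY := S.smooth_φ.apply hY
  rw [nijenhuisBracket, nijenhuisTensor, mlieBracket_eq_of_torsion_eq_zero h0 hX hY,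
    mlieBracket_eq_of_torsion_eq_zero h0 hφX hφY, mlieBracket_eq_of_torsion_eq_zero h0 hX hφY,
    mlieBracket_eq_of_torsion_eq_zero h0 hφX hY]
  simp only [hP X (hX.mdifferentiableAt x), hP Y (hY.mdifferentiableAt x), map_sub, S.φ_sq]
  module

/-- The identity
`∇_X φY - φ∇*_X Y = g(A⁰X, φY) ξ + η(Y) φA⁰X + K_X φY + φK_X Y`. -/
def AlmostContactMetric.StructureIdentity (S : AlmostContactMetric I M)
    (D D' D₀ : AffineConnection I M) : Prop :=
  ∀ X Y : RoughField I M, IsSmoothField I X → IsSmoothField I Y → ∀ x : M,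
    D (fun y => S.φ y (Y y)) x (X x) - S.φ x (D' Y x (X x))
      = S.g.inner x (S.shape D₀ x (X x)) (S.φ x (Y x)) • S.ξ x
        + S.η x (Y x) • S.φ x (S.shape D₀ x (X x))
        + differenceTensor D D₀ X (fun y => S.φ y (Y y)) x
        + S.φ x (differenceTensor D D₀ X Y x)

theorem AlmostContactMetric.structureIdentity_iff_covariantDerivative
    (S : AlmostContactMetric I M) {D D' D₀ : AffineConnection I M}
    (hD : IsStatistical S.g D D') (hD₀ : IsLeviCivita S.g D₀) :
    S.StructureIdentity D D' D₀ ↔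
      ∀ X Y : RoughField I M, IsSmoothField I X → IsSmoothField I Y → ∀ x : M,
        D₀ (fun y => S.φ y (Y y)) x (X x) - S.φ x (D₀ Y x (X x))
          = S.g.inner x (S.shape D₀ x (X x)) (S.φ x (Y x)) • S.ξ x
            + S.η x (Y x) • S.φ x (S.shape D₀ x (X x)) := by
  refine forall₂_congr fun X Y => forall₂_congr fun hX hY => forall_congr' fun x => ?_
  have h1 : D' Y x (X x) = D₀ Y x (X x) + D₀ Y x (X x) - D Y x (X x) :=
    eq_sub_of_add_eq' (hD.add_eq hD₀ hX hY x)
  rw [h1, differenceTensor, differenceTensor, map_sub, map_add, map_sub, ← sub_eq_zero,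
    ← sub_eq_zero (a := D₀ _ x (X x) - _)]
  refine Eq.congr ?_ rfl
  abel

theorem AlmostContactMetric.StructureIdentity.nijenhuisBracket_eq {S : AlmostContactMetric I M}
    (hS : S.IsAlmostCosymplectic) {D D' D₀ : AffineConnection I M}
    (hD : IsStatistical S.g D D') (hD₀ : IsLeviCivita S.g D₀) (h : S.StructureIdentity D D' D₀)
    {X Y : RoughField I M} (hX : IsSmoothField I X) (hY : IsSmoothField I Y) {x : M}
    (hXx : S.η x (X x) = 0) (hYx : S.η x (Y x) = 0) :
    nijenhuisBracket S.φ X Y x = S.η x (VectorField.mlieBracket I X Y x) • S.ξ x := by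
  obtain ⟨P, hjet, hP⟩ := S.exists_isCosymplecticJet hS hD₀ x
  rw [S.nijenhuisBracket_eq hD₀ hP hX hY, hjet.nijenhuisTensor_eq_zero ?_ hXx hYx, add_zero]
  intro u v
  obtain ⟨U, hU, rfl⟩ := exists_isSmoothField_apply_eq u
  obtain ⟨V, hV, rfl⟩ := exists_isSmoothField_apply_eq v
  rw [hP V (hV.mdifferentiableAt x),
    (S.structureIdentity_iff_covariantDerivative hD hD₀).1 h U V hU hV x]
  rfl

theorem AlmostContactMetric.structureIdentity_of_nijenhuisBracket_eq
    {S : AlmostContactMetric I M}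
    (hS : S.IsAlmostCosymplectic) {D D' D₀ : AffineConnection I M}
    (hD : IsStatistical S.g D D') (hD₀ : IsLeviCivita S.g D₀)
    (h : ∀ (x : M) (v w : TangentSpace I x), S.η x v = 0 → S.η x w = 0 →
      ∃ X Y : RoughField I M, IsSmoothField I X ∧ IsSmoothField I Y ∧ X x = v ∧ Y x = w ∧
        nijenhuisBracket S.φ X Y x = S.η x (VectorField.mlieBracket I X Y x) • S.ξ x) :
    S.StructureIdentity D D' D₀ := by
  refine (S.structureIdentity_iff_covariantDerivative hD hD₀).2 fun U V _ hV x => ?_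
  obtain ⟨P, hjet, hP⟩ := S.exists_isCosymplecticJet hS hD₀ x
  rw [← hP V (hV.mdifferentiableAt x), hjet.P_eq_of_nijenhuisTensor_eq_zero ?_]
  · rfl
  intro v w hv hw
  obtain ⟨X, Y, hX, hY, rfl, rfl, hN⟩ := h x v w hv hw
  rw [S.nijenhuisBracket_eq hD₀ hP hX hY] at hN
  exact add_eq_left.1 hN

end Cosymplectic

section InverseFunction

/-- A smooth map with invertible derivative at `a` restricts to a smooth local diffeomorphism. -/
theorem exists_openPartialHomeomorph_of_hasFDerivAt_equiv
    {E F : Type*} [NormedAddCommGroup E] [NormedSpace ℝ E] [CompleteSpace E]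
    [NormedAddCommGroup F] [NormedSpace ℝ F] {f : E → F} {U : Set E} (hU : IsOpen U) {a : E}
    (ha : a ∈ U) (hf : ContDiffOn ℝ ∞ f U) {f' : E ≃L[ℝ] F}
    (hf' : HasFDerivAt f (f' : E →L[ℝ] F) a) :
    ∃ e : OpenPartialHomeomorph E F, a ∈ e.source ∧ e.source ⊆ U ∧ (∀ x, e x = f x) ∧
      ContDiffOn ℝ ∞ e.symm e.target := by
  have hfa : ContDiffAt ℝ ∞ f a := hf.contDiffAt (hU.mem_nhds ha)
  have hn : (∞ : WithTop ℕ∞) ≠ 0 := by simp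
  let e := hfa.toOpenPartialHomeomorph f hf' hn
  have hcont : ContinuousAt (fderiv ℝ f) a :=
    (hfa.fderiv_right (m := 0) (by simp)).continuousAt
  have hV : fderiv ℝ f ⁻¹' Set.range ((↑) : (E ≃L[ℝ] F) → E →L[ℝ] F) ∈ 𝓝 a :=
    hcont.preimage_mem_nhds (by rw [hf'.fderiv]; exact ContinuousLinearEquiv.nhds f')
  obtain ⟨W, hWV, hW, haW⟩ := mem_nhds_iff.1 hV
  refine ⟨e.restrOpen (U ∩ W) (hU.inter hW), ?_, ?_, fun x => rfl, ?_⟩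
  · exact ⟨hfa.mem_toOpenPartialHomeomorph_source hf' hn, ha, haW⟩
  · exact fun x hx => hx.2.1
  · intro y hy
    have hsrc := (e.restrOpen (U ∩ W) (hU.inter hW)).map_target hy
    obtain ⟨g', hg'⟩ := hWV hsrc.2.2
    have hfy := hf.contDiffAt (hU.mem_nhds hsrc.2.1)
    refine (OpenPartialHomeomorph.contDiffAt_symm _ hy (f₀' := g') ?_ ?_).contDiffWithinAt
    · have := (hfy.differentiableAt (by simp)).hasFDerivAt
      rw [← hg'] at this
      exact this
    · exact hfy

end InverseFunction

section Related

/-- The Lie bracket on vector spaces is compatible with related vector fields. -/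
theorem fderiv_lieBracket_of_related
    {E F : Type*} [NormedAddCommGroup E] [NormedSpace ℝ E]
    [NormedAddCommGroup F] [NormedSpace ℝ F] {f : E → F} {a : E} (hf : ContDiffAt ℝ 2 f a)
    {V₁ V₂ : E → E} {W₁ W₂ : F → F} (hV₁ : DifferentiableAt ℝ V₁ a)
    (hV₂ : DifferentiableAt ℝ V₂ a) (hW₁ : DifferentiableAt ℝ W₁ (f a))
    (hW₂ : DifferentiableAt ℝ W₂ (f a))
    (h₁ : ∀ᶠ x in 𝓝 a, fderiv ℝ f x (V₁ x) = W₁ (f x))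
    (h₂ : ∀ᶠ x in 𝓝 a, fderiv ℝ f x (V₂ x) = W₂ (f x)) :
    fderiv ℝ f a (VectorField.lieBracket ℝ V₁ V₂ a) = VectorField.lieBracket ℝ W₁ W₂ (f a) := by
  have hfd : DifferentiableAt ℝ f a := hf.differentiableAt (by simp)
  have hf2 : DifferentiableAt ℝ (fderiv ℝ f) a :=
    (hf.fderiv_right (m := 1) (by norm_num)).differentiableAt (by simp)
  have key : ∀ {V : E → E} {W : F → F}, DifferentiableAt ℝ V a → DifferentiableAt ℝ W (f a) →
      (∀ᶠ x in 𝓝 a, fderiv ℝ f x (V x) = W (f x)) → ∀ u,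
      fderiv ℝ W (f a) (fderiv ℝ f a u)
        = fderiv ℝ f a (fderiv ℝ V a u) + fderiv ℝ (fderiv ℝ f) a u (V a) := by
    intro V W hV hW h u
    have e1 := (hf2.hasFDerivAt.clm_apply hV.hasFDerivAt).congr_of_eventuallyEq
      (h.mono fun _ hx => hx.symm)
    have e2 := (hW.hasFDerivAt.comp a hfd.hasFDerivAt).unique e1
    simpa using congrArg (fun T => T u) e2
  have hsymm : IsSymmSndFDerivAt ℝ f a := hf.isSymmSndFDerivAt (by simp)
  rw [VectorField.lieBracket, VectorField.lieBracket, ← h₁.self_of_nhds, ← h₂.self_of_nhds,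
    key hV₂ hW₂ h₂, key hV₁ hW₁ h₁, hsymm.eq (V₁ a) (V₂ a), map_sub]
  abel

variable {E : Type*} [NormedAddCommGroup E] [NormedSpace ℝ E] [CompleteSpace E]
  {H : Type*} [TopologicalSpace H] {I : ModelWithCorners ℝ E H} [I.Boundaryless]
  {L : Type*} [TopologicalSpace L] [ChartedSpace H L] [IsManifold I ∞ L]
  {E' : Type*} [NormedAddCommGroup E'] [NormedSpace ℝ E'] [CompleteSpace E']
  {H' : Type*} [TopologicalSpace H'] {I' : ModelWithCorners ℝ E' H'} [I'.Boundaryless]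
  {M : Type*} [TopologicalSpace M] [ChartedSpace H' M] [IsManifold I' ∞ M]

/-- A vector field read in the extended chart at `x`, as a function on the manifold. -/
noncomputable def chartReading (I : ModelWithCorners ℝ E H) (x : L) (V : RoughField I L) (y : L) :
    E :=
  mfderiv I 𝓘(ℝ, E) (extChartAt I x) y (V y)

omit [CompleteSpace E] [I.Boundaryless] in
theorem mpullbackWithin_extChartAt_symm_apply (x : L) (V : RoughField I L) {u : E}
    (hu : u ∈ (extChartAt I x).target) :
    VectorField.mpullbackWithin 𝓘(ℝ, E) I (extChartAt I x).symm V (Set.range I) u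
      = chartReading I x V ((extChartAt I x).symm u) := by
  rw [VectorField.mpullbackWithin_apply]
  have h := ContinuousLinearMap.inverse_eq (mfderivWithin_extChartAt_symm_comp_mfderiv_extChartAt
    (I := I) hu) (mfderiv_extChartAt_comp_mfderivWithin_extChartAt_symm (I := I) hu)
  rw [h]
  rfl

omit [CompleteSpace E] in
theorem mfderiv_extChartAt_mlieBracket (x : L) (V W : RoughField I L) :
    mfderiv I 𝓘(ℝ, E) (extChartAt I x) x (VectorField.mlieBracket I V W x)
      = VectorField.lieBracket ℝ
        (fun u => chartReading I x V ((extChartAt I x).symm u))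
        (fun u => chartReading I x W ((extChartAt I x).symm u)) (extChartAt I x x) := by
  rw [← VectorField.mlieBracketWithin_univ, VectorField.mlieBracketWithin_apply]
  refine ((isInvertible_mfderiv_extChartAt (mem_extChartAt_source x)).self_apply_inverse _).trans ?_
  have hev : ∀ V : RoughField I L,
      VectorField.mpullbackWithin 𝓘(ℝ, E) I (extChartAt I x).symm V (Set.range I)
        =ᶠ[𝓝 (extChartAt I x x)] fun u => chartReading I x V ((extChartAt I x).symm u) := fun V =>
    Filter.eventuallyEq_of_mem (extChartAt_target_mem_nhds x)
      fun u hu => mpullbackWithin_extChartAt_symm_apply x V hu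
  have hs : (extChartAt I x).symm ⁻¹' Set.univ ∩ Set.range I = Set.univ := by
    rw [I.range_eq_univ, Set.preimage_univ, Set.univ_inter]
  have e : ∀ (V W : E → E) u, VectorField.lieBracketWithin ℝ V W
      ((extChartAt I x).symm ⁻¹' Set.univ ∩ Set.range I) u = VectorField.lieBracket ℝ V W u := by
    intro V W u
    rw [hs, VectorField.lieBracketWithin_univ]
  exact (e _ _ _).trans ((hev V).lieBracket_vectorField_eq (hev W))

theorem differentiableAt_chartReading {x : L} {V : RoughField I L} (hV : MDiffAt (T% V) x) :
    DifferentiableAt ℝ (fun u => chartReading I x V ((extChartAt I x).symm u))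
      (extChartAt I x x) := by
  have h := MDifferentiableWithinAt.differentiableWithinAt_mpullbackWithin_vectorField
    (mdifferentiableWithinAt_univ.2 hV)
  have hev : (fun u => chartReading I x V ((extChartAt I x).symm u)) =ᶠ[𝓝 (extChartAt I x x)]
      VectorField.mpullbackWithin 𝓘(ℝ, E) I (extChartAt I x).symm V (Set.range I) :=
    Filter.eventuallyEq_of_mem (extChartAt_target_mem_nhds x)
      fun u hu => (mpullbackWithin_extChartAt_symm_apply x V hu).symm
  have h2 := h.congr_of_eventuallyEq (hev.filter_mono nhdsWithin_le_nhds) hev.self_of_nhds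
  rwa [I.range_eq_univ, Set.preimage_univ, Set.univ_inter, differentiableWithinAt_univ] at h2

omit [CompleteSpace E] [CompleteSpace E'] [I'.Boundaryless] in
theorem contDiffAt_writtenInExtChartAt {i : L → M} {p q : L} (hi : ContMDiff I I' ∞ i)
    (hq : q ∈ (extChartAt I p).source) (hiq : i q ∈ (extChartAt I' (i p)).source) :
    ContDiffAt ℝ ∞ (writtenInExtChartAt I I' p i) (extChartAt I p q) := by
  rw [← contMDiffAt_iff_contDiffAt]
  have h1 : ContMDiffAt 𝓘(ℝ, E) I ∞ (extChartAt I p).symm (extChartAt I p q) :=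
    (contMDiffOn_extChartAt_symm p).contMDiffAt
      ((isOpen_extChartAt_target p).mem_nhds ((extChartAt I p).map_source hq))
  have h2 : ContMDiffAt I' 𝓘(ℝ, E') ∞ (extChartAt I' (i p))
      (i ((extChartAt I p).symm (extChartAt I p q))) := by
    rw [(extChartAt I p).left_inv hq]
    exact contMDiffAt_extChartAt' (by simpa using hiq)
  exact h2.comp (extChartAt I p q) ((hi _).comp (extChartAt I p q) h1)

omit [CompleteSpace E] [CompleteSpace E'] [I'.Boundaryless] in
/-- The derivative of a map read in charts. -/
theorem fderiv_writtenInExtChartAt_apply {i : L → M} {p q : L} (hi : ContMDiff I I' ∞ i)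
    (hq : q ∈ (extChartAt I p).source) (hiq : i q ∈ (extChartAt I' (i p)).source)
    (v : TangentSpace I q) :
    fderiv ℝ (writtenInExtChartAt I I' p i) (extChartAt I p q)
        (mfderiv I 𝓘(ℝ, E) (extChartAt I p) q v)
      = mfderiv I' 𝓘(ℝ, E') (extChartAt I' (i p)) (i q) (mfderiv I I' i q v) := by
  have hφ : MDiffAt (extChartAt I p) q := mdifferentiableAt_extChartAt (by simpa using hq)
  have hψ : MDiffAt (extChartAt I' (i p)) (i q) := mdifferentiableAt_extChartAt (by simpa using hiq)
  have hiq' : MDiffAt i q := (hi q).mdifferentiableAt (by simp)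
  have hF : DifferentiableAt ℝ (writtenInExtChartAt I I' p i) (extChartAt I p q) :=
    (contDiffAt_writtenInExtChartAt hi hq hiq).differentiableAt (by simp)
  have hev : (writtenInExtChartAt I I' p i) ∘ (extChartAt I p) =ᶠ[𝓝 q] extChartAt I' (i p) ∘ i := by
    filter_upwards [(isOpen_extChartAt_source p).mem_nhds hq] with y hy
    rw [Function.comp_apply, writtenInExtChartAt, Function.comp_apply, Function.comp_apply,
      (extChartAt I p).left_inv hy, Function.comp_apply]
  have h1 := hev.mfderiv_eq (I := I) (I' := 𝓘(ℝ, E'))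
  rw [mfderiv_comp q hF.mdifferentiableAt hφ, mfderiv_comp q hψ hiq', mfderiv_eq_fderiv] at h1
  exact congrArg (fun T => T v) h1

/-- The Lie bracket is compatible with related vector fields. -/
theorem mfderiv_mlieBracket_of_related {i : L → M} {p : L} (hi : ContMDiff I I' ∞ i)
    {V₁ V₂ : RoughField I L} {W₁ W₂ : RoughField I' M} (hV₁ : MDiffAt (T% V₁) p)
    (hV₂ : MDiffAt (T% V₂) p) (hW₁ : MDiffAt (T% W₁) (i p)) (hW₂ : MDiffAt (T% W₂) (i p))
    (h₁ : ∀ᶠ q in 𝓝 p, mfderiv I I' i q (V₁ q) = W₁ (i q))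
    (h₂ : ∀ᶠ q in 𝓝 p, mfderiv I I' i q (V₂ q) = W₂ (i q)) :
    mfderiv I I' i p (VectorField.mlieBracket I V₁ V₂ p)
      = VectorField.mlieBracket I' W₁ W₂ (i p) := by
  have hFp : writtenInExtChartAt I I' p i (extChartAt I p p) = extChartAt I' (i p) (i p) := by
    simp [writtenInExtChartAt]
  have hF : ContDiffAt ℝ ∞ (writtenInExtChartAt I I' p i) (extChartAt I p p) :=
    contDiffAt_writtenInExtChartAt hi (mem_extChartAt_source p) (mem_extChartAt_source (i p))
  have hrel : ∀ {V : RoughField I L} {W : RoughField I' M},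
      (∀ᶠ q in 𝓝 p, mfderiv I I' i q (V q) = W (i q)) →
      ∀ᶠ u in 𝓝 (extChartAt I p p), fderiv ℝ (writtenInExtChartAt I I' p i) u
        (chartReading I p V ((extChartAt I p).symm u))
        = chartReading I' (i p) W
          ((extChartAt I' (i p)).symm (writtenInExtChartAt I I' p i u)) := by
    intro V W h
    have hc : Filter.Tendsto (extChartAt I p).symm (𝓝 (extChartAt I p p)) (𝓝 p) := by
      simpa using (continuousAt_extChartAt_symm (I := I) p).tendsto
    filter_upwards [extChartAt_target_mem_nhds (I := I) p, hc.eventually h,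
      hc.eventually ((hi.continuous.continuousAt (x := p)).preimage_mem_nhds
        (extChartAt_source_mem_nhds (I := I') (i p)))] with u hu hq hiq
    have h3 := fderiv_writtenInExtChartAt_apply hi ((extChartAt I p).map_target hu) hiq
      (V ((extChartAt I p).symm u))
    rw [(extChartAt I p).right_inv hu] at h3
    have h4 : (extChartAt I' (i p)).symm (writtenInExtChartAt I I' p i u)
        = i ((extChartAt I p).symm u) := (extChartAt I' (i p)).left_inv hiq
    rw [h4, chartReading, chartReading, ← hq]
    exact h3
  have hd : ∀ {W : RoughField I' M}, MDiffAt (T% W) (i p) →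
      DifferentiableAt ℝ (fun u => chartReading I' (i p) W ((extChartAt I' (i p)).symm u))
        (writtenInExtChartAt I I' p i (extChartAt I p p)) := fun hW => by
    rw [hFp]
    exact differentiableAt_chartReading hW
  have key := fderiv_lieBracket_of_related (hF.of_le ENat.LEInfty.out)
    (differentiableAt_chartReading hV₁) (differentiableAt_chartReading hV₂) (hd hW₁) (hd hW₂)
    (hrel h₁) (hrel h₂)
  rw [hFp, ← mfderiv_extChartAt_mlieBracket, ← mfderiv_extChartAt_mlieBracket,
    fderiv_writtenInExtChartAt_apply hi (mem_extChartAt_source p) (mem_extChartAt_source (i p))]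
    at key
  exact (isInvertible_mfderiv_extChartAt (mem_extChartAt_source (i p))).injective key

end Related

section Immersion

variable {E : Type*} [NormedAddCommGroup E] [NormedSpace ℝ E] [FiniteDimensional ℝ E]
  {H : Type*} [TopologicalSpace H] {I : ModelWithCorners ℝ E H} [I.Boundaryless]
  {L : Type*} [TopologicalSpace L] [ChartedSpace H L] [IsManifold I ∞ L]
  {E' : Type*} [NormedAddCommGroup E'] [NormedSpace ℝ E'] [FiniteDimensional ℝ E']
  {H' : Type*} [TopologicalSpace H'] {I' : ModelWithCorners ℝ E' H'} [I'.Boundaryless]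
  {M : Type*} [TopologicalSpace M] [ChartedSpace H' M] [IsManifold I' ∞ M]

omit [FiniteDimensional ℝ E] [FiniteDimensional ℝ E'] [I.Boundaryless] [I'.Boundaryless]
  [IsManifold I ∞ L] [IsManifold I' ∞ M] in
theorem exists_continuousLinearMap_leftInverse [FiniteDimensional ℝ E'] (A : E →L[ℝ] E')
    (hA : Function.Injective A) : ∃ B : E' →L[ℝ] E, ∀ v, B (A v) = v := by
  obtain ⟨B, hB⟩ := (A : E →ₗ[ℝ] E').exists_leftInverse_of_injective (LinearMap.ker_eq_bot.2 hA)
  exact ⟨LinearMap.toContinuousLinearMap B, fun v => congrArg (fun T => T v) hB⟩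

omit [I'.Boundaryless] in
/-- An immersion has a smooth local left inverse. -/
theorem exists_local_leftInverse {i : L → M} (hi : ContMDiff I I' ∞ i) {p : L}
    (hp : Function.Injective (mfderiv I I' i p)) :
    ∃ ρ : M → L, (∀ᶠ x in 𝓝 (i p), ContMDiffAt I' I ∞ ρ x) ∧ ∀ᶠ q in 𝓝 p, ρ (i q) = q := by
  have : CompleteSpace E := FiniteDimensional.complete ℝ E
  set F := writtenInExtChartAt I I' p i with hFdef
  set u₀ := extChartAt I p p
  have hFsm := contDiffAt_writtenInExtChartAt hi (mem_extChartAt_source (I := I) p)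
    (mem_extChartAt_source (I := I') (i p))
  have hinj : Function.Injective (fderiv ℝ F u₀) := by
    intro a b hab
    obtain ⟨a', rfl⟩ := (isInvertible_mfderiv_extChartAt (I := I)
      (mem_extChartAt_source p)).surjective a
    obtain ⟨b', rfl⟩ := (isInvertible_mfderiv_extChartAt (I := I)
      (mem_extChartAt_source p)).surjective b
    have h1 := (fderiv_writtenInExtChartAt_apply hi (mem_extChartAt_source p)
      (mem_extChartAt_source (i p)) a').symm.trans (hab.trans
        (fderiv_writtenInExtChartAt_apply hi (mem_extChartAt_source p)
      (mem_extChartAt_source (i p)) b'))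
    rw [hp ((isInvertible_mfderiv_extChartAt (mem_extChartAt_source (i p))).injective h1)]
  obtain ⟨B, hB⟩ := exists_continuousLinearMap_leftInverse _ hinj
  let U : Set E := (extChartAt I p).target ∩
    (extChartAt I p).symm ⁻¹' (i ⁻¹' (extChartAt I' (i p)).source)
  have hU : IsOpen U := (continuousOn_extChartAt_symm p).isOpen_inter_preimage
    (isOpen_extChartAt_target p) ((isOpen_extChartAt_source (i p)).preimage hi.continuous)
  have hu₀ : u₀ ∈ U := ⟨mem_extChartAt_target p, by simp [u₀]⟩
  have hFU : ContDiffOn ℝ ∞ (fun u => B (F u)) U := by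
    intro u hu
    have h1 := contDiffAt_writtenInExtChartAt hi ((extChartAt I p).map_target hu.1) hu.2
    rw [(extChartAt I p).right_inv hu.1] at h1
    exact (B.contDiff.contDiffAt.comp u h1).contDiffWithinAt
  have hder : HasFDerivAt (fun u => B (F u)) ((ContinuousLinearEquiv.refl ℝ E : E ≃L[ℝ] E) :
      E →L[ℝ] E) u₀ := by
    have h1 := B.hasFDerivAt.comp u₀ (hFsm.differentiableAt (by simp)).hasFDerivAt
    refine h1.congr_fderiv ?_
    ext v
    exact hB v
  obtain ⟨e, he₀, heU, hef, hesymm⟩ := exists_openPartialHomeomorph_of_hasFDerivAt_equiv hU hu₀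
    hFU hder
  have hFi : ∀ q ∈ (extChartAt I p).source, F (extChartAt I p q) = extChartAt I' (i p) (i q) := by
    intro q hq
    rw [hFdef, writtenInExtChartAt, Function.comp_apply, Function.comp_apply,
      (extChartAt I p).left_inv hq]
  refine ⟨fun x => (extChartAt I p).symm (e.symm (B (extChartAt I' (i p) x))), ?_, ?_⟩
  · have hmem : B (extChartAt I' (i p) (i p)) ∈ e.target := by
      rw [← hFi p (mem_extChartAt_source p), ← hef]
      exact e.map_source he₀
    have hopen : ∀ᶠ x in 𝓝 (i p), B (extChartAt I' (i p) x) ∈ e.target :=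
      (B.continuous.continuousAt.comp (continuousAt_extChartAt (i p))).preimage_mem_nhds
        (e.open_target.mem_nhds hmem)
    filter_upwards [hopen, extChartAt_source_mem_nhds (I := I') (i p)] with x hx hxs
    have h1 : ContMDiffAt I' 𝓘(ℝ, E) ∞ (fun x => B (extChartAt I' (i p) x)) x :=
      B.contMDiff.contMDiffAt.comp x (contMDiffAt_extChartAt' (by simpa using hxs))
    have h2 : ContMDiffAt 𝓘(ℝ, E) 𝓘(ℝ, E) ∞ e.symm (B (extChartAt I' (i p) x)) :=
      (hesymm.contDiffAt (e.open_target.mem_nhds hx)).contMDiffAt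
    have h3 : ContMDiffAt 𝓘(ℝ, E) I ∞ (extChartAt I p).symm
        (e.symm (B (extChartAt I' (i p) x))) :=
      (contMDiffOn_extChartAt_symm p).contMDiffAt
        ((isOpen_extChartAt_target p).mem_nhds (heU (e.map_target hx)).1)
    exact h3.comp x (h2.comp x h1)
  · have hopen : ∀ᶠ q in 𝓝 p, extChartAt I p q ∈ e.source :=
      (continuousAt_extChartAt p).preimage_mem_nhds (e.open_source.mem_nhds he₀)
    filter_upwards [hopen, extChartAt_source_mem_nhds (I := I) p] with q hq hqs
    rw [← hFi q hqs, ← hef, e.left_inv hq, (extChartAt I p).left_inv hqs]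

omit [FiniteDimensional ℝ E] [FiniteDimensional ℝ E'] [I.Boundaryless] [I'.Boundaryless] in
/-- The image of a vector field under the derivative of a map is smooth along another map. -/
theorem contMDiffAt_mfderiv_apply {N EN HN : Type*} [NormedAddCommGroup EN] [NormedSpace ℝ EN]
    [TopologicalSpace HN] {IN : ModelWithCorners ℝ EN HN} [TopologicalSpace N]
    [ChartedSpace HN N] {f : L → M} {b : N → L} {V : ∀ x, TangentSpace I (b x)} {x : N}
    (hf : ContMDiffAt I I' ∞ f (b x)) (hb : ContMDiffAt IN I ∞ b x)
    (hV : ContMDiffAt IN I.tangent ∞ (fun x => (⟨b x, V x⟩ : TangentBundle I L)) x) :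
    ContMDiffAt IN I'.tangent ∞
      (fun x => (⟨f (b x), mfderiv I I' f (b x) (V x)⟩ : TangentBundle I' M)) x := by
  have h := (hf.mfderiv_const (m := ∞) (by simp)).comp x hb
  exact ContMDiffAt.clm_apply_of_inCoordinates (b₁ := b) (b₂ := fun x => f (b x)) h hV
    (hf.comp x hb)

omit [FiniteDimensional ℝ E] [FiniteDimensional ℝ E'] [I.Boundaryless] [I'.Boundaryless] in
theorem mdifferentiableAt_mfderiv_apply {f : L → M} {V : RoughField I L} {x : L}
    (hf : ContMDiffAt I I' ∞ f x) (hV : MDiffAt (T% V) x) :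
    MDifferentiableAt I I'.tangent
      (fun x => (⟨f x, mfderiv I I' f x (V x)⟩ : TangentBundle I' M)) x := by
  have h := (hf.mfderiv_const (m := ∞) (by simp)).mdifferentiableAt (by simp)
  exact MDifferentiableAt.clm_apply_of_inCoordinates (b₁ := id) (b₂ := f) h hV
    (hf.mdifferentiableAt (by simp))

omit [I'.Boundaryless] in
/-- A field on the source of an immersion that is related to a smooth field is smooth. -/
theorem contMDiffAt_of_related {i : L → M} (hi : ContMDiff I I' ∞ i) {p : L}
    (hp : Function.Injective (mfderiv I I' i p)) {W : RoughField I L} {V : RoughField I' M}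
    (hV : ContMDiffAt I' I'.tangent ∞ (T% V) (i p))
    (hW : ∀ᶠ q in 𝓝 p, mfderiv I I' i q (W q) = V (i q)) :
    ContMDiffAt I I.tangent ∞ (T% W) p := by
  obtain ⟨ρ, hρ, hρi⟩ := exists_local_leftInverse hi hp
  have h1 : ContMDiffAt I I'.tangent ∞ (fun q => (⟨i q, V (i q)⟩ : TangentBundle I' M)) p :=
    hV.comp p (hi p)
  have h2 := contMDiffAt_mfderiv_apply (f := ρ) (b := i) hρ.self_of_nhds (hi p) h1
  refine h2.congr_of_eventuallyEq ?_
  filter_upwards [hW, hρi.eventually_nhds, (hi.continuous.tendsto p).eventually hρ]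
    with q hq hρq hρs
  have hid : (ρ ∘ i) =ᶠ[𝓝 q] id := hρq
  have h3 := hid.mfderiv_eq (I := I) (I' := I)
  rw [mfderiv_comp q (hρs.mdifferentiableAt (by simp)) ((hi q).mdifferentiableAt (by simp)),
    mfderiv_id] at h3
  have h4 : mfderiv I' I ρ (i q) (V (i q)) = W q := by
    rw [← hq]
    exact congrArg (fun T => T (W q)) h3
  have h5 := hρq.self_of_nhds
  refine Bundle.TotalSpace.ext h5.symm ?_
  exact heq_of_eq h4.symm

end Immersion

section ExtensionOperator

variable {E : Type*} [NormedAddCommGroup E] [NormedSpace ℝ E] [FiniteDimensional ℝ E]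
  {H : Type*} [TopologicalSpace H] {I : ModelWithCorners ℝ E H} [I.Boundaryless]
  {L : Type*} [TopologicalSpace L] [ChartedSpace H L] [IsManifold I ∞ L]
  {E' : Type*} [NormedAddCommGroup E'] [NormedSpace ℝ E'] [FiniteDimensional ℝ E']
  {H' : Type*} [TopologicalSpace H'] {I' : ModelWithCorners ℝ E' H'}
  {M : Type*} [TopologicalSpace M] [T2Space M] [ChartedSpace H' M] [IsManifold I' ∞ M]

variable (I I') in
/-- `ext` extends vector fields on the immersed manifold `i : L → M` to vector fields on `M`
that are related to them near `p`, linearly over a local left inverse `ρ` of `i`. -/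
structure IsExtensionOperator (i : L → M) (p : L) (ρ : M → L)
    (ext : RoughField I L → RoughField I' M) : Prop where
  mdifferentiableAt_retraction : MDifferentiableAt I' I ρ (i p)
  leftInverse : ∀ᶠ q in 𝓝 p, ρ (i q) = q
  add : ∀ σ τ : RoughField I L, ext (σ + τ) = ext σ + ext τ
  smul : ∀ (f : L → ℝ) (σ : RoughField I L), ext (f • σ) = (f ∘ ρ) • ext σ
  mdifferentiableAt : ∀ σ : RoughField I L, MDiffAt (T% σ) p → MDiffAt (T% (ext σ)) (i p)
  smooth : ∀ σ : RoughField I L, IsSmoothField I σ → IsSmoothField I' (ext σ)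
  related : ∀ σ : RoughField I L, ∀ᶠ q in 𝓝 p, mfderiv I I' i q (σ q) = ext σ (i q)

theorem exists_isExtensionOperator {i : L → M} (hi : ContMDiff I I' ∞ i) {p : L}
    (hp : Function.Injective (mfderiv I I' i p)) :
    ∃ ρ ext, IsExtensionOperator I I' i p ρ ext := by
  obtain ⟨ρ, hρ, hρi⟩ := exists_local_leftInverse hi hp
  let e := trivializationAt E' (TangentSpace I' : M → Type _) (i p)
  have hρp : ρ (i p) = p := hρi.self_of_nhds
  have hbase : i p ∈ e.baseSet := FiberBundle.mem_baseSet_trivializationAt' (i p)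
  have hnhds : ∀ᶠ x in 𝓝 (i p), ContMDiffAt I' I ∞ ρ x ∧ i (ρ x) ∈ e.baseSet ∧ x ∈ e.baseSet := by
    refine hρ.and (Filter.Eventually.and ?_ (e.open_baseSet.mem_nhds hbase))
    refine (hi.continuous.continuousAt.comp hρ.self_of_nhds.continuousAt).preimage_mem_nhds
      (e.open_baseSet.mem_nhds ?_)
    rwa [Function.comp_apply, hρp]
  obtain ⟨U, hUP, hU, hpU⟩ := eventually_nhds_iff.1 hnhds
  obtain ⟨b, hb, hbU, hb1⟩ := exists_smoothBump_tsupport_subset (I := I') (hU.mem_nhds hpU)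
  let w : RoughField I L → L → E' := fun σ q =>
    e.continuousLinearMapAt ℝ (i q) (mfderiv I I' i q (σ q))
  have hw_eq : ∀ σ q, i q ∈ e.baseSet →
      w σ q = (e (⟨i q, mfderiv I I' i q (σ q)⟩ : TangentBundle I' M)).2 := by
    intro σ q hq
    exact congrFun (e.coe_linearMapAt_of_mem (R := ℝ) hq) _
  have hw_nhds : ∀ q, i q ∈ e.baseSet → ∀ᶠ y in 𝓝 q, i y ∈ e.baseSet := fun q hq =>
    hi.continuous.continuousAt.preimage_mem_nhds (e.open_baseSet.mem_nhds hq)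
  have hw_smooth : ∀ (σ : RoughField I L) (q : L), i q ∈ e.baseSet →
      ContMDiffAt I I.tangent ∞ (T% σ) q →
      ContMDiffAt I 𝓘(ℝ, E') ∞ (w σ) q := by
    intro σ q hq hσ
    have h1 := contMDiffAt_mfderiv_apply (f := i) (b := id) (hi q) contMDiffAt_id hσ
    have h2 := ((e.contMDiffAt_iff (e.mem_source.2 hq)).1 h1).2
    refine h2.congr_of_eventuallyEq ?_
    filter_upwards [hw_nhds q hq] with y hy using hw_eq σ y hy
  have hw_mdiff : ∀ (σ : RoughField I L) (q : L), i q ∈ e.baseSet → MDiffAt (T% σ) q →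
      MDifferentiableAt I 𝓘(ℝ, E') (w σ) q := by
    intro σ q hq hσ
    have h1 := mdifferentiableAt_mfderiv_apply (f := i) (hi q) hσ
    have h2 : MDifferentiableAt (I'.prod 𝓘(ℝ, E')) (I'.prod 𝓘(ℝ, E')) e
        (⟨i q, mfderiv I I' i q (σ q)⟩ : TangentBundle I' M) :=
      ((e.contMDiffOn (n := 1)).contMDiffAt (e.open_source.mem_nhds
        (e.mem_source.2 hq))).mdifferentiableAt (by simp)
    have h3 := (mdifferentiableAt_snd.comp _ (h2.comp q h1))
    refine h3.congr_of_eventuallyEq ?_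
    filter_upwards [hw_nhds q hq] with y hy using hw_eq σ y hy
  let s : RoughField I L → RoughField I' M := fun σ x => e.symmL ℝ x (w σ (ρ x))
  refine ⟨ρ, fun σ => b • s σ, ?_, hρi, ?_, ?_, ?_, ?_, ?_⟩
  · exact hρ.self_of_nhds.mdifferentiableAt (by simp)
  · intro σ τ
    ext x
    simp [s, w]
  · intro f σ
    ext x
    simp only [s, w, Pi.smul_apply', map_smul, Function.comp_apply]
    rw [smul_comm]
  · intro σ hσ
    have h1 : MDifferentiableAt I' 𝓘(ℝ, E') (fun x => w σ (ρ x)) (i p) := by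
      refine MDifferentiableAt.comp (I' := I) (g := w σ) (f := ρ) (i p) ?_
        (hρ.self_of_nhds.mdifferentiableAt (by simp))
      rw [hρp]
      exact hw_mdiff σ p hbase hσ
    have h2 : MDiffAt (T% (s σ)) (i p) := by
      refine MDifferentiableAt.clm_bundle_apply (E₁ := Bundle.Trivial M E')
        (b := id) ((e.contMDiffAt_symmL (n := 1) hbase).mdifferentiableAt (by simp)) ?_
      exact (mdifferentiableAt_section _ _).2 h1
    exact (hb.mdifferentiableAt (by simp)).smul_section h2
  · intro σ hσ
    refine ContMDiffOn.smul_section_of_tsupport hb.contMDiffOn hU hbU fun x hx => ?_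
    obtain ⟨hx1, hx2, hx3⟩ := hUP x hx
    have h1 : ContMDiffAt I' 𝓘(ℝ, E') ∞ (fun x => w σ (ρ x)) x :=
      (hw_smooth σ (ρ x) hx2 (hσ _)).comp x hx1
    have h2 : ContMDiffAt I' I'.tangent ∞ (T% (s σ)) x := by
      refine ContMDiffAt.clm_bundle_apply (E₁ := Bundle.Trivial M E')
        (b := id) (e.contMDiffAt_symmL (n := ∞) hx3) ?_
      exact (contMDiffAt_section _).2 h1
    exact h2.contMDiffWithinAt
  · intro σ
    filter_upwards [hρi, hw_nhds p hbase, (hi.continuous.tendsto p).eventually hb1] with q h1 h2 h3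
    simp only [Pi.smul_apply', h3, one_smul, s, w]
    rw [h1]
    exact (e.symmL_continuousLinearMapAt h2 _).symm

end ExtensionOperator

section HomBundle

variable {E : Type*} [NormedAddCommGroup E] [NormedSpace ℝ E] [FiniteDimensional ℝ E]
  {H : Type*} [TopologicalSpace H] {I : ModelWithCorners ℝ E H}
  {L : Type*} [TopologicalSpace L] [ChartedSpace H L]

/-- A family of linear maps is smooth if its values on all vectors are. -/
theorem contMDiffAt_clm_of_apply {F : Type*} [NormedAddCommGroup F] [NormedSpace ℝ F]
    {f : L → E →L[ℝ] F} {p : L} (h : ∀ v, ContMDiffAt I 𝓘(ℝ, F) ∞ (fun x => f x v) p) :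
    ContMDiffAt I 𝓘(ℝ, E →L[ℝ] F) ∞ f p := by
  let d := Module.finrank ℝ E
  have hd : d = Module.finrank ℝ (Fin d → ℝ) := (Module.finrank_fin_fun ℝ).symm
  let e₁ := ContinuousLinearEquiv.ofFinrankEq hd
  let e₂ := (e₁.arrowCongr (1 : F ≃L[ℝ] F)).trans (ContinuousLinearEquiv.piRing (Fin d))
  have h1 : ContMDiffAt I 𝓘(ℝ, Fin d → F) ∞ (fun x => e₂ (f x)) p :=
    contMDiffAt_pi_space.2 fun j => h _
  have h2 := (e₂.symm : (Fin d → F) →L[ℝ] E →L[ℝ] F).contMDiff.contMDiffAt.comp p h1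
  refine h2.congr_of_eventuallyEq (Filter.Eventually.of_forall fun x => ?_)
  simp

variable [T2Space L] [IsManifold I ∞ L]
  {F : Type*} [NormedAddCommGroup F] [NormedSpace ℝ F]
  {V : L → Type*} [TopologicalSpace (TotalSpace F V)]
  [∀ x, AddCommGroup (V x)] [∀ x, Module ℝ (V x)] [∀ x : L, TopologicalSpace (V x)]
  [∀ x, IsTopologicalAddGroup (V x)] [∀ x, ContinuousSMul ℝ (V x)]
  [FiberBundle F V] [VectorBundle ℝ F V]

/-- A family of linear maps on the tangent spaces is smooth if its values on all smooth vector
fields are. -/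
theorem contMDiffAt_hom_of_apply {Φ : ∀ x : L, TangentSpace I x →L[ℝ] V x} {p : L}
    (h : ∀ X : RoughField I L, IsSmoothField I X →
      ContMDiffAt I (I.prod 𝓘(ℝ, F)) ∞ (fun x => TotalSpace.mk' F x (Φ x (X x))) p) :
    ContMDiffAt I (I.prod 𝓘(ℝ, E →L[ℝ] F)) ∞
      (fun x => TotalSpace.mk' (E →L[ℝ] F) (E := fun x : L => TangentSpace I x →L[ℝ] V x)
        x (Φ x)) p := by
  rw [contMDiffAt_hom_bundle]
  refine ⟨contMDiffAt_id, contMDiffAt_clm_of_apply fun v => ?_⟩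
  let e := trivializationAt E (TangentSpace I : L → Type _) p
  have hbase : p ∈ e.baseSet := FiberBundle.mem_baseSet_trivializationAt' p
  have hsm : ∀ y ∈ e.baseSet, ContMDiffAt I I.tangent ∞
      (T% (fun x => e.symmL ℝ x v : RoughField I L)) y := fun y hy => by
    refine ContMDiffAt.clm_bundle_apply (E₁ := Bundle.Trivial L E)
      (b := id) (e.contMDiffAt_symmL (n := ∞) hy) ?_
    exact (contMDiffAt_section _).2 contMDiffAt_const
  obtain ⟨X, hX, hXv⟩ := exists_isSmoothField_eventuallyEq (I := I) (x := p)
    (X := fun x => e.symmL ℝ x v)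
    (Filter.eventually_of_mem (e.open_baseSet.mem_nhds hbase) hsm)
  refine ((contMDiffAt_section _).1 (h X hX)).congr_of_eventuallyEq ?_
  have hbaseV : p ∈ (trivializationAt F V p).baseSet := FiberBundle.mem_baseSet_trivializationAt' p
  filter_upwards [hXv, e.open_baseSet.mem_nhds hbase,
    (trivializationAt F V p).open_baseSet.mem_nhds hbaseV] with x hx hxe hxV
  rw [ContinuousLinearMap.inCoordinates_eq (x := x) (y := x) hxe hxV, hx]
  simp [e]
  congr 3
  exact congrArg (Φ x) (e.symmL_apply (R := ℝ) hxe v).symm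

end HomBundle

section InducedStructure

variable {l m : ℕ}
  {M : Type u} [TopologicalSpace M] [ChartedSpace (EuclideanSpace ℝ (Fin m)) M]
  {L : Type u} [TopologicalSpace L] [ChartedSpace (EuclideanSpace ℝ (Fin l)) L]
  {η : RoughForm (𝓡 m) M} {i : L → M}

theorem IsIntegralManifold.η_mfderiv (hi : IsIntegralManifold l η i) (p : L)
    (v : TangentSpace (𝓡 l) p) : η (i p) (mfderiv (𝓡 l) (𝓡 m) i p v) = 0 :=
  (hi.tangent p _).1 ⟨v, rfl⟩

theorem IsIntegralManifold.exists_lift (hi : IsIntegralManifold l η i) (p : L) :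
    ∃ K : TangentSpace (𝓡 m) (i p) →L[ℝ] TangentSpace (𝓡 l) p,
      ∀ v, K (mfderiv (𝓡 l) (𝓡 m) i p v) = v :=
  exists_continuousLinearMap_leftInverse (E := EuclideanSpace ℝ (Fin l))
    (E' := EuclideanSpace ℝ (Fin m)) (mfderiv (𝓡 l) (𝓡 m) i p) (hi.immersion p)

/-- A left inverse of the derivative of an integral manifold. -/
noncomputable def IsIntegralManifold.lift (hi : IsIntegralManifold l η i) (p : L) :
    TangentSpace (𝓡 m) (i p) →L[ℝ] TangentSpace (𝓡 l) p :=
  (hi.exists_lift p).choose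

theorem IsIntegralManifold.lift_mfderiv (hi : IsIntegralManifold l η i) (p : L)
    (v : TangentSpace (𝓡 l) p) : hi.lift p (mfderiv (𝓡 l) (𝓡 m) i p v) = v :=
  (hi.exists_lift p).choose_spec v

theorem IsIntegralManifold.mfderiv_lift (hi : IsIntegralManifold l η i) (p : L)
    {w : TangentSpace (𝓡 m) (i p)} (hw : η (i p) w = 0) :
    mfderiv (𝓡 l) (𝓡 m) i p (hi.lift p w) = w := by
  obtain ⟨v, rfl⟩ := (hi.tangent p w).2 hw
  rw [hi.lift_mfderiv]

theorem IsIntegralManifold.t2Space [T2Space M] (hi : IsIntegralManifold l η i) : T2Space L :=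
  T2Space.of_injective_continuous hi.injective hi.smooth.continuous

variable [T2Space M] [IsManifold (𝓡 m) ∞ M] [IsManifold (𝓡 l) ∞ L]

/-- The restriction of a field of endomorphisms to an integral manifold. -/
noncomputable def IsIntegralManifold.endo (hi : IsIntegralManifold l η i) (φ : RoughEndo (𝓡 m) M) :
    RoughEndo (𝓡 l) L :=
  fun p => (hi.lift p).comp ((φ (i p)).comp (mfderiv (𝓡 l) (𝓡 m) i p))

omit [T2Space M] [IsManifold (𝓡 m) ∞ M] [IsManifold (𝓡 l) ∞ L] in
theorem IsIntegralManifold.mfderiv_endo (hi : IsIntegralManifold l η i) {φ : RoughEndo (𝓡 m) M}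
    (hφ : ∀ x w, η x (φ x w) = 0) (p : L) (v : TangentSpace (𝓡 l) p) :
    mfderiv (𝓡 l) (𝓡 m) i p (hi.endo φ p v) = φ (i p) (mfderiv (𝓡 l) (𝓡 m) i p v) :=
  hi.mfderiv_lift p (hφ _ _)

theorem IsIntegralManifold.isSmoothEndo (hi : IsIntegralManifold l η i) {φ : RoughEndo (𝓡 m) M}
    (hφs : IsSmoothEndo (𝓡 m) φ) (hφ : ∀ x w, η x (φ x w) = 0) :
    IsSmoothEndo (𝓡 l) (hi.endo φ) := by
  have := hi.t2Space
  intro p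
  refine contMDiffAt_hom_of_apply fun X hX => ?_
  obtain ⟨ρ, ext, hext⟩ := exists_isExtensionOperator hi.smooth (hi.immersion p)
  refine contMDiffAt_of_related (W := fun q => hi.endo φ q (X q)) hi.smooth (hi.immersion p)
    (hφs.apply (hext.smooth X hX) (i p)) ?_
  filter_upwards [hext.related X] with q hq
  rw [← hq]
  exact hi.mfderiv_endo hφ q _

/-- The pullback of a metric at a point. -/
noncomputable def pullbackInner (g : Metric (𝓡 m) M) (i : L → M) (p : L) :
    TangentSpace (𝓡 l) p →L[ℝ] TangentSpace (𝓡 l) p →L[ℝ] ℝ :=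
  (ContinuousLinearMap.precomp ℝ (mfderiv (𝓡 l) (𝓡 m) i p)).comp
    ((g.inner (i p)).comp (mfderiv (𝓡 l) (𝓡 m) i p))

/-- The metric induced on an integral manifold. -/
noncomputable def IsIntegralManifold.metric (hi : IsIntegralManifold l η i) (g : Metric (𝓡 m) M) :
    Metric (𝓡 l) L where
  inner p := pullbackInner g i p
  symm p v w := g.symm _ _ _
  pos p v hv := g.pos _ _ fun h => hv (hi.immersion p (h.trans (map_zero _).symm))
  isVonNBounded p := by
    refine ((g.isVonNBounded (i p)).image (hi.lift p)).subset fun v hv => ?_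
    exact ⟨mfderiv (𝓡 l) (𝓡 m) i p v, hv, hi.lift_mfderiv p v⟩
  contMDiff p := by
    have := hi.t2Space
    refine contMDiffAt_hom_of_apply fun X hX => ?_
    refine contMDiffAt_hom_of_apply (V := Bundle.Trivial L ℝ) fun Y hY => ?_
    refine (contMDiffAt_section _).2 ?_
    obtain ⟨ρ, ext, hext⟩ := exists_isExtensionOperator hi.smooth (hi.immersion p)
    have h := (contMDiffAt_metric g (hext.smooth X hX (i p)) (hext.smooth Y hY (i p))).comp p
      (hi.smooth p)
    refine h.congr_of_eventuallyEq ?_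
    filter_upwards [hext.related X, hext.related Y] with q h1 h2
    rw [Function.comp_apply, ← h1, ← h2]
    rfl

end InducedStructure

section Conjugate

variable {E : Type*} [NormedAddCommGroup E] [NormedSpace ℝ E] [FiniteDimensional ℝ E]
  {H : Type*} [TopologicalSpace H] {I : ModelWithCorners ℝ E H}
  {M : Type*} [TopologicalSpace M] [ChartedSpace H M] [IsManifold I ∞ M]

omit [FiniteDimensional ℝ E] in
theorem AreConjugate.symm {g : Metric I M} {D D' : AffineConnection I M}
    (h : AreConjugate g D D') : AreConjugate g D' D := by
  intro X Y Z hX hY hZ x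
  have h1 := h Y X Z hY hX hZ x
  have h2 : (fun y => g.inner y (X y) (Y y)) = fun y => g.inner y (Y y) (X y) :=
    funext fun y => g.symm y _ _
  rw [h2, h1, g.symm x _ (X x), g.symm x (Y x), add_comm]

theorem IsStatistical.symm {g : Metric I M} {D D' : AffineConnection I M}
    (h : IsStatistical g D D') : IsStatistical g D' D :=
  ⟨h.smooth', h.smooth, h.torsion_free', h.torsion_free, h.conjugate.symm⟩

omit [FiniteDimensional ℝ E] [IsManifold I ∞ M] in
theorem mvfderiv_apply_of_comp_eventuallyEq {E' : Type*} [NormedAddCommGroup E'] [NormedSpace ℝ E']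
    {H' : Type*} [TopologicalSpace H'] {I' : ModelWithCorners ℝ E' H'}
    {L : Type*} [TopologicalSpace L] [ChartedSpace H' L] {i : L → M} {p : L}
    {f : M → ℝ} {h : L → ℝ} (hf : MDiffAt f (i p)) (hi : MDiffAt i p)
    (hh : ∀ᶠ q in 𝓝 p, f (i q) = h q) (v : TangentSpace I' p) :
    mvfderiv I f (i p) (mfderiv I' I i p v) = mvfderiv I' h p v := by
  refine (mvfderiv_comp_apply p hf hi v).symm.trans ?_
  have hev : f ∘ i =ᶠ[𝓝 p] h := hh
  exact congrArg (fun T => T v) (hev.mfderiv_eq (I := I') (I' := 𝓘(ℝ)))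

/-- If a connection has a conjugate, its derivatives along a submanifold depend only on the
values of the field on the submanifold. -/
theorem AreConjugate.apply_mfderiv_eq_zero [T2Space M] {g : Metric I M}
    {D D' : AffineConnection I M} (h : AreConjugate g D D')
    {E' : Type*} [NormedAddCommGroup E'] [NormedSpace ℝ E']
    {H' : Type*} [TopologicalSpace H'] {I' : ModelWithCorners ℝ E' H'}
    {L : Type*} [TopologicalSpace L] [ChartedSpace H' L] {i : L → M} {p : L} (hi : MDiffAt i p)
    {W : RoughField I M} (hW : IsSmoothField I W) (hWi : ∀ᶠ q in 𝓝 p, W (i q) = 0)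
    (v : TangentSpace I' p) : D W (i p) (mfderiv I' I i p v) = 0 := by
  have key : ∀ u : TangentSpace I (i p), g.inner (i p) (D W (i p) (mfderiv I' I i p v)) u = 0 := by
    intro u
    obtain ⟨Y, hY, rfl⟩ := exists_isSmoothField_apply_eq u
    obtain ⟨Z, hZ, hZv⟩ := exists_isSmoothField_apply_eq (mfderiv I' I i p v)
    have h1 := h W Y Z hW hY hZ (i p)
    rw [hWi.self_of_nhds, map_zero, zero_apply, add_zero, hZv, dirDeriv, hZv,
      mvfderiv_apply_of_comp_eventuallyEq (h := fun _ => 0)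
        ((contMDiffAt_metric g (hW _) (hY _)).mdifferentiableAt (by simp)) hi
        (by filter_upwards [hWi] with q hq; rw [hq, map_zero, zero_apply]), mvfderiv_const] at h1
    exact h1.symm
  by_contra hne
  exact (g.pos _ _ hne).ne' (key _)

theorem AreConjugate.apply_mfderiv_congr [T2Space M] {g : Metric I M}
    {D D' : AffineConnection I M} (h : AreConjugate g D D')
    {E' : Type*} [NormedAddCommGroup E'] [NormedSpace ℝ E']
    {H' : Type*} [TopologicalSpace H'] {I' : ModelWithCorners ℝ E' H'}
    {L : Type*} [TopologicalSpace L] [ChartedSpace H' L] {i : L → M} {p : L} (hi : MDiffAt i p)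
    {W W' : RoughField I M} (hW : IsSmoothField I W) (hW' : IsSmoothField I W')
    (hWi : ∀ᶠ q in 𝓝 p, W (i q) = W' (i q)) (v : TangentSpace I' p) :
    D W (i p) (mfderiv I' I i p v) = D W' (i p) (mfderiv I' I i p v) := by
  have hs : IsSmoothField I (W - W') := ContMDiff.sub_section hW hW'
  have h0 := h.apply_mfderiv_eq_zero hi hs
    (by filter_upwards [hWi] with q hq; simp [hq]) v
  have h1 := D.isCovariantDerivativeOnUniv.add (hs.mdifferentiableAt (i p))
    (hW'.mdifferentiableAt (i p))
  rw [sub_add_cancel] at h1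
  rw [h1, add_apply, h0, zero_add]

omit [FiniteDimensional ℝ E] in
theorem contMDiff_connection_apply {D : AffineConnection I M}
    (hD : CovariantDerivative.ContMDiffCovariantDerivative D ∞) {X Y : RoughField I M}
    (hX : IsSmoothField I X) (hY : IsSmoothField I Y) :
    IsSmoothField I (fun x => D Y x (X x)) := by
  have h1 := hD.contMDiff.contMDiff (σ := Y) (contMDiffOn_univ.2 (ContMDiff.of_le hY (by simp)))
  exact ContMDiff.clm_bundle_apply (F₁ := E) (E₁ := fun x : M => TangentSpace I x)
    (contMDiffOn_univ.1 h1) hX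

end Conjugate

section InducedConnection

variable {l m : ℕ}
  {M : Type u} [TopologicalSpace M] [T2Space M] [ChartedSpace (EuclideanSpace ℝ (Fin m)) M]
  [IsManifold (𝓡 m) ∞ M]
  {L : Type u} [TopologicalSpace L] [ChartedSpace (EuclideanSpace ℝ (Fin l)) L]
  [IsManifold (𝓡 l) ∞ L] {S : AlmostContactMetric (𝓡 m) M} {i : L → M}

/-- The orthogonal projection onto the kernel of `η`. -/
noncomputable def AlmostContactMetric.proj (S : AlmostContactMetric (𝓡 m) M) (x : M) :
    TangentSpace (𝓡 m) x →L[ℝ] TangentSpace (𝓡 m) x :=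
  ContinuousLinearMap.id ℝ _ - (S.η x).smulRight (S.ξ x)

omit [T2Space M] in
theorem AlmostContactMetric.proj_apply (S : AlmostContactMetric (𝓡 m) M) (x : M)
    (w : TangentSpace (𝓡 m) x) : S.proj x w = w - S.η x w • S.ξ x := rfl

omit [T2Space M] in
theorem AlmostContactMetric.η_proj (S : AlmostContactMetric (𝓡 m) M) (x : M)
    (w : TangentSpace (𝓡 m) x) : S.η x (S.proj x w) = 0 := by
  simp [S.proj_apply, S.η_ξ]

omit [T2Space M] in
theorem AlmostContactMetric.proj_of_η_eq_zero (S : AlmostContactMetric (𝓡 m) M) {x : M}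
    {w : TangentSpace (𝓡 m) x} (hw : S.η x w = 0) : S.proj x w = w := by
  simp [S.proj_apply, hw]

omit [T2Space M] in
theorem AlmostContactMetric.isSmoothField_proj (S : AlmostContactMetric (𝓡 m) M)
    {X : RoughField (𝓡 m) M} (hX : IsSmoothField (𝓡 m) X) :
    IsSmoothField (𝓡 m) (fun x => S.proj x (X x)) := by
  have h : ContMDiff (𝓡 m) 𝓘(ℝ) ∞ (fun x => S.η x (X x)) :=
    fun x => S.smooth_η.contMDiffAt_apply (hX x)
  exact ContMDiff.sub_section hX (h.smul_section S.smooth_ξ)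

theorem IsIntegralManifold.exists_extensionOperators (hi : IsIntegralManifold l S.η i) :
    ∃ (ρ : L → M → L) (ext : L → RoughField (𝓡 l) L → RoughField (𝓡 m) M),
      ∀ p, IsExtensionOperator (𝓡 l) (𝓡 m) i p (ρ p) (ext p) := by
  choose ρ ext h using fun p => exists_isExtensionOperator hi.smooth (hi.immersion p)
  exact ⟨ρ, ext, h⟩

theorem IsIntegralManifold.exists_connection (hi : IsIntegralManifold l S.η i)
    {D D' : AffineConnection (𝓡 m) M} (hD : AreConjugate S.g D D') :
    ∃ DL : AffineConnection (𝓡 l) L, IsInducedConnection l S i D DL := by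
  obtain ⟨ρ, ext, hext⟩ := hi.exists_extensionOperators
  have hid : ∀ p, MDifferentiableAt (𝓡 l) (𝓡 m) i p := fun p =>
    (hi.smooth p).mdifferentiableAt (by simp)
  have hρp : ∀ p, ρ p (i p) = p := fun p => (hext p).leftInverse.self_of_nhds
  let cov : RoughField (𝓡 l) L → ∀ p : L, TangentSpace (𝓡 l) p →L[ℝ] TangentSpace (𝓡 l) p :=
    fun σ p => (hi.lift p).comp ((S.proj (i p)).comp
      ((D (ext p σ) (i p)).comp (mfderiv (𝓡 l) (𝓡 m) i p)))
  have hcov_apply : ∀ σ p v, cov σ p v = hi.lift p (S.proj (i p)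
    (D (ext p σ) (i p) (mfderiv (𝓡 l) (𝓡 m) i p v))) := fun σ p v => rfl
  refine ⟨⟨cov, ?_, ?_⟩, ?_⟩
  · intro σ τ p hσ hτ _
    ext1 v
    rw [add_apply, hcov_apply, hcov_apply, hcov_apply, (hext p).add,
      D.isCovariantDerivativeOnUniv.add ((hext p).mdifferentiableAt σ hσ)
        ((hext p).mdifferentiableAt τ hτ)]
    simp only [add_apply, map_add]
  · intro σ f p hσ hf _
    ext1 v
    have hfρ : MDifferentiableAt (𝓡 m) 𝓘(ℝ) (f ∘ ρ p) (i p) := by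
      refine MDifferentiableAt.comp (i p) ?_ (hext p).mdifferentiableAt_retraction
      rw [hρp]
      exact hf
    have hd : mvfderiv (𝓡 m) (f ∘ ρ p) (i p) (mfderiv (𝓡 l) (𝓡 m) i p v)
        = mvfderiv (𝓡 l) f p v :=
      mvfderiv_apply_of_comp_eventuallyEq hfρ (hid p)
        ((hext p).leftInverse.mono fun q hq => congrArg f hq) v
    rw [hcov_apply, (hext p).smul,
      D.isCovariantDerivativeOnUniv.leibniz ((hext p).mdifferentiableAt σ hσ) hfρ]
    simp only [add_apply, smul_apply, ContinuousLinearMap.smulRight_apply, map_add, map_smul,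
      hd, hcov_apply, Function.comp_apply, hρp]
    rw [← ((hext p).related σ).self_of_nhds, S.proj_of_η_eq_zero (hi.η_mfderiv p _),
      hi.lift_mfderiv]
  · intro Y Z hY hZ p hYZ v
    refine (hi.mfderiv_lift p (S.η_proj _ _)).trans ?_
    rw [← S.proj_apply, ← hD.apply_mfderiv_congr (hid p) ((hext p).smooth Y hY) hZ ?_ v]
    · rfl
    filter_upwards [hYZ, (hext p).related Y] with q h1 h2
    rw [← h1, ← h2]

variable {D D' : AffineConnection (𝓡 m) M} {DL DL' : AffineConnection (𝓡 l) L}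

theorem IsInducedConnection.contMDiff (hi : IsIntegralManifold l S.η i)
    (h : IsInducedConnection l S i D DL)
    (hD : CovariantDerivative.ContMDiffCovariantDerivative D ∞) :
    CovariantDerivative.ContMDiffCovariantDerivative DL ∞ := by
  have := hi.t2Space
  refine ⟨⟨fun {σ} hσ => contMDiffOn_univ.2 fun p => ?_⟩⟩
  have hσ' : IsSmoothField (𝓡 l) σ :=
    (contMDiffOn_univ.1 hσ).of_le (by simp)
  refine contMDiffAt_hom_of_apply fun X hX => ?_
  obtain ⟨ρ, ext, hext⟩ := exists_isExtensionOperator hi.smooth (hi.immersion p)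
  refine contMDiffAt_of_related (W := fun q => DL σ q (X q)) hi.smooth (hi.immersion p)
    (S.isSmoothField_proj (contMDiff_connection_apply hD (hext.smooth X hX)
      (hext.smooth σ hσ')) (i p)) ?_
  filter_upwards [hext.related X, (hext.related σ).eventually_nhds] with q h1 h2
  rw [← h1]
  exact h σ (ext σ) hσ' (hext.smooth σ hσ') q h2 (X q)

theorem IsInducedConnection.torsion_eq_zero (hi : IsIntegralManifold l S.η i)
    (h : IsInducedConnection l S i D DL) (hD : ∀ x, D.torsion x = 0) (p : L) :
    DL.torsion p = 0 := by
  have := hi.t2Space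
  ext1 v
  ext1 w
  obtain ⟨X, hX, rfl⟩ := exists_isSmoothField_apply_eq v
  obtain ⟨Y, hY, rfl⟩ := exists_isSmoothField_apply_eq w
  obtain ⟨ρ, ext, hext⟩ := exists_isExtensionOperator hi.smooth (hi.immersion p)
  have hX' := hext.smooth X hX
  have hY' := hext.smooth Y hY
  rw [DL.torsion_apply (hX.mdifferentiableAt p) (hY.mdifferentiableAt p), zero_apply, zero_apply,
    sub_eq_zero]
  refine hi.immersion p ?_
  have hb := mfderiv_mlieBracket_of_related hi.smooth (hX.mdifferentiableAt p)
    (hY.mdifferentiableAt p) (hX'.mdifferentiableAt _) (hY'.mdifferentiableAt _)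
    (hext.related X) (hext.related Y)
  have hη := hi.η_mfderiv p (VectorField.mlieBracket (𝓡 l) X Y p)
  rw [map_sub, h Y _ hY hY' p (hext.related Y), h X _ hX hX' p (hext.related X), hb,
    ← S.proj_apply, ← S.proj_apply, ← map_sub, (hext.related X).self_of_nhds,
    (hext.related Y).self_of_nhds, ← mlieBracket_eq_of_torsion_eq_zero (hD _) hX' hY']
  rw [hb] at hη
  exact S.proj_of_η_eq_zero hη

theorem IsInducedConnection.areConjugate (hi : IsIntegralManifold l S.η i)
    (h : IsInducedConnection l S i D DL) (h' : IsInducedConnection l S i D' DL')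
    (hD : AreConjugate S.g D D') : AreConjugate (hi.metric S.g) DL DL' := by
  intro X Y Z hX hY hZ p
  obtain ⟨ρ, ext, hext⟩ := exists_isExtensionOperator hi.smooth (hi.immersion p)
  have hX' := hext.smooth X hX
  have hY' := hext.smooth Y hY
  have hZ' := hext.smooth Z hZ
  have hx := S.isAlmostContactVectorSpace (i p)
  have key := hD _ _ _ hX' hY' hZ' (i p)
  rw [dirDeriv, ← (hext.related Z).self_of_nhds, mvfderiv_apply_of_comp_eventuallyEq
    (h := fun q => (hi.metric S.g).inner q (X q) (Y q))
    ((contMDiffAt_metric S.g (hX' _) (hY' _)).mdifferentiableAt (by simp))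
    ((hi.smooth p).mdifferentiableAt (by simp))
    (by filter_upwards [hext.related X, hext.related Y] with q h1 h2; rw [← h1, ← h2]; rfl)] at key
  refine key.trans ?_
  have e : ∀ v w : TangentSpace (𝓡 l) p, (hi.metric S.g).inner p v w = S.g.inner (i p)
    (mfderiv (𝓡 l) (𝓡 m) i p v) (mfderiv (𝓡 l) (𝓡 m) i p w) := fun v w => rfl
  have hηX := hi.η_mfderiv p (X p)
  have hηY := hi.η_mfderiv p (Y p)
  rw [e, e, h X _ hX hX' p (hext.related X), h' Y _ hY hY' p (hext.related Y),
    ← (hext.related X).self_of_nhds, ← (hext.related Y).self_of_nhds]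
  simp only [map_sub, map_smul, sub_apply, smul_apply, hx.g_ξ, hηX, hx.symm (S.ξ (i p)), hηY,
    smul_zero, sub_zero]

end InducedConnection

section KaehlerLeaf

variable {l m : ℕ}
  {M : Type u} [TopologicalSpace M] [T2Space M] [ChartedSpace (EuclideanSpace ℝ (Fin m)) M]
  [IsManifold (𝓡 m) ∞ M]
  {L : Type u} [TopologicalSpace L] [ChartedSpace (EuclideanSpace ℝ (Fin l)) L]
  [IsManifold (𝓡 l) ∞ L] {S : AlmostContactMetric (𝓡 m) M} {i : L → M}

omit [T2Space M] in
/-- The Nijenhuis torsions of related endomorphism fields are related. -/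
theorem mfderiv_nijenhuisBracket {J : RoughEndo (𝓡 l) L} {φ : RoughEndo (𝓡 m) M}
    (hi : ContMDiff (𝓡 l) (𝓡 m) ∞ i) (hJ : IsSmoothEndo (𝓡 l) J) (hφ : IsSmoothEndo (𝓡 m) φ)
    (hJφ : ∀ (p : L) (v : TangentSpace (𝓡 l) p),
      mfderiv (𝓡 l) (𝓡 m) i p (J p v) = φ (i p) (mfderiv (𝓡 l) (𝓡 m) i p v))
    {X Y : RoughField (𝓡 l) L} {X' Y' : RoughField (𝓡 m) M}
    (hX : IsSmoothField (𝓡 l) X) (hY : IsSmoothField (𝓡 l) Y)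
    (hX' : IsSmoothField (𝓡 m) X') (hY' : IsSmoothField (𝓡 m) Y') {p : L}
    (hXX' : ∀ᶠ q in 𝓝 p, mfderiv (𝓡 l) (𝓡 m) i q (X q) = X' (i q))
    (hYY' : ∀ᶠ q in 𝓝 p, mfderiv (𝓡 l) (𝓡 m) i q (Y q) = Y' (i q)) :
    mfderiv (𝓡 l) (𝓡 m) i p (nijenhuisBracket J X Y p) = nijenhuisBracket φ X' Y' (i p) := by
  have hb : ∀ {X Y : RoughField (𝓡 l) L} {X' Y' : RoughField (𝓡 m) M},
      IsSmoothField (𝓡 l) X → IsSmoothField (𝓡 l) Y → IsSmoothField (𝓡 m) X' →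
      IsSmoothField (𝓡 m) Y' → (∀ᶠ q in 𝓝 p, mfderiv (𝓡 l) (𝓡 m) i q (X q) = X' (i q)) →
      (∀ᶠ q in 𝓝 p, mfderiv (𝓡 l) (𝓡 m) i q (Y q) = Y' (i q)) →
      mfderiv (𝓡 l) (𝓡 m) i p (VectorField.mlieBracket (𝓡 l) X Y p)
        = VectorField.mlieBracket (𝓡 m) X' Y' (i p) := fun hX hY hX' hY' h1 h2 =>
    mfderiv_mlieBracket_of_related hi (hX.mdifferentiableAt p) (hY.mdifferentiableAt p)
      (hX'.mdifferentiableAt _) (hY'.mdifferentiableAt _) h1 h2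
  have hr : ∀ {X : RoughField (𝓡 l) L} {X' : RoughField (𝓡 m) M},
      (∀ᶠ q in 𝓝 p, mfderiv (𝓡 l) (𝓡 m) i q (X q) = X' (i q)) →
      ∀ᶠ q in 𝓝 p, mfderiv (𝓡 l) (𝓡 m) i q (J q (X q)) = φ (i q) (X' (i q)) := fun h => by
    filter_upwards [h] with q hq
    rw [hJφ, hq]
  rw [nijenhuisBracket, nijenhuisBracket, ← hb hX hY hX' hY' hXX' hYY',
    ← hb (hJ.apply hX) (hJ.apply hY) (hφ.apply hX') (hφ.apply hY') (hr hXX') (hr hYY'),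
    ← hb hX (hJ.apply hY) hX' (hφ.apply hY') hXX' (hr hYY'),
    ← hb (hJ.apply hX) hY (hφ.apply hX') hY' (hr hXX') hYY']
  simp only [map_add, map_sub, hJφ]

/-- The almost Hermitian structure induced on an integral manifold. -/
noncomputable def IsIntegralManifold.almostHermitian (hi : IsIntegralManifold l S.η i) :
    AlmostHermitian (𝓡 l) L where
  J := hi.endo S.φ
  g := hi.metric S.g
  smooth_J := hi.isSmoothEndo S.smooth_φ fun x => (S.isAlmostContactVectorSpace x).η_φ
  J_sq p v := by
    have hφ := fun x => (S.isAlmostContactVectorSpace x).η_φ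
    refine hi.immersion p ?_
    rw [hi.mfderiv_endo hφ, hi.mfderiv_endo hφ, S.φ_sq, hi.η_mfderiv, zero_smul, add_zero, map_neg]
  compat p v w := by
    have hφ := fun x => (S.isAlmostContactVectorSpace x).η_φ
    have e : ∀ v w : TangentSpace (𝓡 l) p, (hi.metric S.g).inner p v w = S.g.inner (i p)
      (mfderiv (𝓡 l) (𝓡 m) i p v) (mfderiv (𝓡 l) (𝓡 m) i p w) := fun v w => rfl
    rw [e, e, hi.mfderiv_endo hφ, hi.mfderiv_endo hφ]
    exact (S.isAlmostContactVectorSpace (i p)).φ_skew _ _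

theorem IsIntegralManifold.mfderiv_J (hi : IsIntegralManifold l S.η i) (p : L)
    (v : TangentSpace (𝓡 l) p) :
    mfderiv (𝓡 l) (𝓡 m) i p (hi.almostHermitian.J p v)
      = S.φ (i p) (mfderiv (𝓡 l) (𝓡 m) i p v) :=
  hi.mfderiv_endo (fun x => (S.isAlmostContactVectorSpace x).η_φ) p v

theorem IsIntegralManifold.isClosedTwoForm (hi : IsIntegralManifold l S.η i)
    (hS : S.IsAlmostCosymplectic) :
    IsClosedTwoForm (𝓡 l) (fun p v w =>
      hi.almostHermitian.g.inner p (hi.almostHermitian.J p v) w) := by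
  intro X Y Z hX hY hZ p
  obtain ⟨ρ, ext, hext⟩ := exists_isExtensionOperator hi.smooth (hi.immersion p)
  have key := hS.closed_Φ _ _ _ (hext.smooth X hX) (hext.smooth Y hY) (hext.smooth Z hZ) (i p)
  have hΩ : ∀ q (v w : TangentSpace (𝓡 l) q),
      hi.almostHermitian.g.inner q (hi.almostHermitian.J q v) w
        = S.g.inner (i q) (S.φ (i q) (mfderiv (𝓡 l) (𝓡 m) i q v))
          (mfderiv (𝓡 l) (𝓡 m) i q w) := fun q v w =>
    congrArg (fun u => S.g.inner (i q) u (mfderiv (𝓡 l) (𝓡 m) i q w)) (hi.mfderiv_J q v)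
  have hd : ∀ {X Y Z : RoughField (𝓡 l) L}, IsSmoothField (𝓡 l) Y → IsSmoothField (𝓡 l) Z →
      dirDeriv (𝓡 m) (ext X) (fun y => S.g.inner y (S.φ y (ext Y y)) (ext Z y)) (i p)
        = dirDeriv (𝓡 l) X (fun q => hi.almostHermitian.g.inner q
            (hi.almostHermitian.J q (Y q)) (Z q)) p := by
    intro X Y Z hY hZ
    rw [dirDeriv, ← (hext.related X).self_of_nhds]
    refine mvfderiv_apply_of_comp_eventuallyEq
      ((contMDiffAt_metric S.g (S.smooth_φ.apply (hext.smooth Y hY) _)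
        (hext.smooth Z hZ _)).mdifferentiableAt (by simp))
      ((hi.smooth p).mdifferentiableAt (by simp)) ?_ _
    filter_upwards [hext.related Y, hext.related Z] with q h1 h2
    rw [hΩ, h1, h2]
  have hb : ∀ {X Y : RoughField (𝓡 l) L}, IsSmoothField (𝓡 l) X → IsSmoothField (𝓡 l) Y →
      VectorField.mlieBracket (𝓡 m) (ext X) (ext Y) (i p)
        = mfderiv (𝓡 l) (𝓡 m) i p (VectorField.mlieBracket (𝓡 l) X Y p) := fun {X Y} hX hY =>
    (mfderiv_mlieBracket_of_related hi.smooth (hX.mdifferentiableAt p) (hY.mdifferentiableAt p)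
      ((hext.smooth X hX).mdifferentiableAt _) ((hext.smooth Y hY).mdifferentiableAt _)
      (hext.related X) (hext.related Y)).symm
  rw [hd hY hZ, hd hZ hX, hd hX hY, hb hX hY, hb hY hZ, hb hZ hX,
    ← (hext.related X).self_of_nhds, ← (hext.related Y).self_of_nhds,
    ← (hext.related Z).self_of_nhds] at key
  beta_reduce
  rw [hΩ, hΩ, hΩ]
  exact key

/-- Under the structure identity, every integral manifold of `η = 0` is a Kaehler statistical
manifold. -/
theorem IsIntegralManifold.isKaehlerStatisticalLeaf (hi : IsIntegralManifold l S.η i)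
    (hS : S.IsAlmostCosymplectic) {D D' D₀ : AffineConnection (𝓡 m) M}
    (hD : IsStatistical S.g D D') (hD₀ : IsLeviCivita S.g D₀) (h : S.StructureIdentity D D' D₀) :
    IsKaehlerStatisticalLeaf l S D D' i := by
  obtain ⟨DL, hDL⟩ := hi.exists_connection hD.conjugate
  obtain ⟨DL', hDL'⟩ := hi.exists_connection hD.symm.conjugate
  refine ⟨hi.almostHermitian, DL, DL', hi.mfderiv_J, fun p v w => rfl, hDL, hDL',
    ⟨hi.isClosedTwoForm hS, fun X Y hX hY p => ?_⟩,
    ⟨hDL.contMDiff hi hD.smooth, hDL'.contMDiff hi hD.smooth',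
      hDL.torsion_eq_zero hi hD.torsion_free, hDL'.torsion_eq_zero hi hD.torsion_free',
      hDL.areConjugate hi hDL' hD.conjugate⟩⟩
  obtain ⟨ρ, ext, hext⟩ := exists_isExtensionOperator hi.smooth (hi.immersion p)
  have hX' := hext.smooth X hX
  have hY' := hext.smooth Y hY
  have hN := mfderiv_nijenhuisBracket hi.smooth hi.almostHermitian.smooth_J S.smooth_φ hi.mfderiv_J
    hX hY hX' hY' (hext.related X) (hext.related Y)
  have hb := mfderiv_mlieBracket_of_related hi.smooth (hX.mdifferentiableAt p)
    (hY.mdifferentiableAt p) (hX'.mdifferentiableAt _) (hY'.mdifferentiableAt _)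
    (hext.related X) (hext.related Y)
  have hηX := hi.η_mfderiv p (X p)
  have hηY := hi.η_mfderiv p (Y p)
  rw [(hext.related X).self_of_nhds] at hηX
  rw [(hext.related Y).self_of_nhds] at hηY
  rw [h.nijenhuisBracket_eq hS hD hD₀ hX' hY' hηX hηY, ← hb, hi.η_mfderiv, zero_smul] at hN
  exact hi.immersion p (hN.trans (map_zero _).symm)

/-- The integral manifolds through all points detect the structure identity. -/
theorem AlmostContactMetric.structureIdentity_of_isKaehlerStatisticalLeaf
    (hS : S.IsAlmostCosymplectic) {D D' D₀ : AffineConnection (𝓡 m) M}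
    (hD : IsStatistical S.g D D') (hD₀ : IsLeviCivita S.g D₀)
    (h : ∀ x : M, ∃ (L : Type u) (_ : TopologicalSpace L)
      (_ : ChartedSpace (EuclideanSpace ℝ (Fin l)) L) (_ : IsManifold (𝓡 l) ∞ L) (i : L → M),
      IsIntegralManifold l S.η i ∧ x ∈ Set.range i ∧ IsKaehlerStatisticalLeaf l S D D' i) :
    S.StructureIdentity D D' D₀ := by
  refine AlmostContactMetric.structureIdentity_of_nijenhuisBracket_eq hS hD hD₀
    fun x v w hv hw => ?_
  obtain ⟨L, _, _, _, i, hi, ⟨p, rfl⟩, T, DL, DL', hJ, -, -, -, hK⟩ := h x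
  have := hi.t2Space
  obtain ⟨v', rfl⟩ := (hi.tangent p v).2 hv
  obtain ⟨w', rfl⟩ := (hi.tangent p w).2 hw
  obtain ⟨X, hX, rfl⟩ := exists_isSmoothField_apply_eq v'
  obtain ⟨Y, hY, rfl⟩ := exists_isSmoothField_apply_eq w'
  obtain ⟨ρ, ext, hext⟩ := exists_isExtensionOperator hi.smooth (hi.immersion p)
  have hX' := hext.smooth X hX
  have hY' := hext.smooth Y hY
  refine ⟨ext X, ext Y, hX', hY', (hext.related X).self_of_nhds.symm,
    (hext.related Y).self_of_nhds.symm, ?_⟩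
  have hN := mfderiv_nijenhuisBracket hi.smooth T.smooth_J S.smooth_φ hJ
    hX hY hX' hY' (hext.related X) (hext.related Y)
  have hb := mfderiv_mlieBracket_of_related hi.smooth (hX.mdifferentiableAt p)
    (hY.mdifferentiableAt p) (hX'.mdifferentiableAt _) (hY'.mdifferentiableAt _)
    (hext.related X) (hext.related Y)
  have h0 : nijenhuisBracket T.J X Y p = 0 := hK.kaehler.nijenhuis X Y hX hY p
  rw [← hN, h0, map_zero, ← hb, hi.η_mfderiv, zero_smul]

end KaehlerLeaf

section Primitive

variable {E : Type*} [NormedAddCommGroup E] [NormedSpace ℝ E] [FiniteDimensional ℝ E]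
  {M : Type*} [TopologicalSpace M] [T2Space M] [ChartedSpace E M] [IsManifold 𝓘(ℝ, E) ∞ M]

/-- A constant vector field, read in the chart at `x`. -/
noncomputable def chartField (x : M) (a : E) : RoughField 𝓘(ℝ, E) M :=
  VectorField.mpullback 𝓘(ℝ, E) 𝓘(ℝ, E) (extChartAt 𝓘(ℝ, E) x) (fun _ => a)

omit [FiniteDimensional ℝ E] [T2Space M] in
theorem mfderiv_chartField {x y : M} (hy : y ∈ (extChartAt 𝓘(ℝ, E) x).source) (a : E) :
    mfderiv 𝓘(ℝ, E) 𝓘(ℝ, E) (extChartAt 𝓘(ℝ, E) x) y (chartField x a y) = a :=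
  (isInvertible_mfderiv_extChartAt hy).self_apply_inverse a

omit [FiniteDimensional ℝ E] [T2Space M] in
theorem chartField_mfderiv {x y : M} (hy : y ∈ (extChartAt 𝓘(ℝ, E) x).source)
    (w : TangentSpace 𝓘(ℝ, E) y) :
    chartField (E := E) x (mfderiv 𝓘(ℝ, E) 𝓘(ℝ, E) (extChartAt 𝓘(ℝ, E) x) y w) y = w :=
  (isInvertible_mfderiv_extChartAt hy).injective (mfderiv_chartField hy _)

omit [T2Space M] in
theorem contMDiffAt_chartField {x y : M} (hy : y ∈ (extChartAt 𝓘(ℝ, E) x).source) (a : E) :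
    ContMDiffAt 𝓘(ℝ, E) 𝓘(ℝ, E).tangent ∞ (T% (chartField x a)) y := by
  have : CompleteSpace E := FiniteDimensional.complete ℝ E
  refine ContMDiffAt.mpullback_vectorField_preimage (n := ∞) ?_
    (contMDiffAt_extChartAt' (by simpa using hy)) (isInvertible_mfderiv_extChartAt hy) (by simp)
  exact contMDiffAt_vectorSpace_iff_contDiffAt.2 contDiffAt_const

omit [T2Space M] in
theorem mlieBracket_chartField {x y : M} (hy : y ∈ (extChartAt 𝓘(ℝ, E) x).source) (a b : E) :
    VectorField.mlieBracket 𝓘(ℝ, E) (chartField x a) (chartField x b) y = 0 := by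
  have : CompleteSpace E := FiniteDimensional.complete ℝ E
  have hc : ∀ a : E, MDifferentiableAt 𝓘(ℝ, E) 𝓘(ℝ, E).tangent
      (fun u => (⟨u, a⟩ : TangentBundle 𝓘(ℝ, E) E)) (extChartAt 𝓘(ℝ, E) x y) := fun a =>
    ((contMDiffAt_vectorSpace_iff_contDiffAt (n := 1) (V := fun _ => a)).2
      contDiffAt_const).mdifferentiableAt (by simp)
  have : IsManifold 𝓘(ℝ, E) (minSmoothness ℝ 2) M := by
    rw [minSmoothness_of_isRCLikeNormedField]
    infer_instance
  have h := VectorField.mpullback_mlieBracket (I := 𝓘(ℝ, E)) (I' := 𝓘(ℝ, E)) (n := ∞)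
    (f := extChartAt 𝓘(ℝ, E) x) (x₀ := y) (V := fun _ => a) (W := fun _ => b) (hc a) (hc b)
    (contMDiffAt_extChartAt' (by simpa using hy)) (by
      rw [minSmoothness_of_isRCLikeNormedField]
      exact ENat.LEInfty.out)
  have h0 : VectorField.mlieBracket 𝓘(ℝ, E) (fun _ => a) (fun _ => b) (extChartAt 𝓘(ℝ, E) x y)
      = (0 : E) := by
    have e := congrFun (VectorField.mlieBracketWithin_eq_lieBracketWithin (𝕜 := ℝ) (E := E)
      (V := fun _ => a) (W := fun _ => b) (s := Set.univ)) (extChartAt 𝓘(ℝ, E) x y)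
    exact e.trans (by
      simp only [VectorField.lieBracketWithin, fderivWithin_fun_const]
      exact sub_self (0 : E))
  refine h.symm.trans ((congrArg _ h0).trans (map_zero _))

/-- A closed one-form is locally the derivative of a function. -/
theorem exists_primitive {η : RoughForm 𝓘(ℝ, E) M} (hη : IsSmoothForm 𝓘(ℝ, E) η)
    (hcl : IsClosedOneForm 𝓘(ℝ, E) η) (x : M) :
    ∃ (U : Set E) (f : E → ℝ), IsOpen U ∧ extChartAt 𝓘(ℝ, E) x x ∈ U ∧
      U ⊆ (extChartAt 𝓘(ℝ, E) x).target ∧ ContDiffOn ℝ ∞ f U ∧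
      ∀ y ∈ (extChartAt 𝓘(ℝ, E) x).source, extChartAt 𝓘(ℝ, E) x y ∈ U →
        ∀ w, fderiv ℝ f (extChartAt 𝓘(ℝ, E) x y)
          (mfderiv 𝓘(ℝ, E) 𝓘(ℝ, E) (extChartAt 𝓘(ℝ, E) x) y w) = η y w := by
  have : CompleteSpace E := FiniteDimensional.complete ℝ E
  set χ := extChartAt 𝓘(ℝ, E) x with hχ
  have hχs : ∀ y ∈ χ.source, ContMDiffAt 𝓘(ℝ, E) 𝓘(ℝ, E) ∞ χ y := fun y hy =>
    contMDiffAt_extChartAt' (by simpa [hχ] using hy)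
  let h : E → M → ℝ := fun a y => η y (chartField x a y)
  have hh : ∀ a, ∀ y ∈ χ.source, ContMDiffAt 𝓘(ℝ, E) 𝓘(ℝ) ∞ (h a) y := fun a y hy =>
    hη.contMDiffAt_apply (contMDiffAt_chartField hy a)
  let α : E → E →L[ℝ] ℝ := fun u => (η (χ.symm u)).comp
    ((mfderiv 𝓘(ℝ, E) 𝓘(ℝ, E) χ (χ.symm u)).inverse : E →L[ℝ] E)
  have hα_apply : ∀ u a, α u a = h a (χ.symm u) := fun u a => rfl
  have hα : ContDiffOn ℝ ∞ α χ.target := by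
    intro u hu
    refine ContDiffAt.contDiffWithinAt ?_
    rw [← contMDiffAt_iff_contDiffAt]
    refine contMDiffAt_clm_of_apply fun a => ?_
    exact (hh a _ (χ.map_target hu)).comp u ((contMDiffOn_extChartAt_symm x).contMDiffAt
      ((isOpen_extChartAt_target x).mem_nhds hu))
  have hαd : ∀ u ∈ χ.target, DifferentiableAt ℝ α u := fun u hu =>
    (hα.contDiffAt ((isOpen_extChartAt_target x).mem_nhds hu)).differentiableAt (by simp)
  have hder : ∀ y ∈ χ.source, ∀ a b,
      mvfderiv 𝓘(ℝ, E) (h b) y (chartField x a y) = fderiv ℝ α (χ y) a b := by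
    intro y hy a b
    have h1 : DifferentiableAt ℝ (fun u => α u b) (χ y) :=
      (hαd _ (χ.map_source hy)).clm_apply (differentiableAt_const b)
    have h2 := mvfderiv_apply_of_comp_eventuallyEq (I := 𝓘(ℝ, E)) (I' := 𝓘(ℝ, E)) (i := χ) (p := y)
      (f := fun u => α u b) (h := h b) h1.mdifferentiableAt
      ((hχs y hy).mdifferentiableAt (by simp)) (by
        filter_upwards [(isOpen_extChartAt_source x).mem_nhds hy] with q hq
        rw [hα_apply, χ.left_inv hq]) (chartField x a y)
    rw [← h2, mfderiv_chartField hy]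
    have h3 : mvfderiv 𝓘(ℝ, E) (fun u => α u b) (χ y) = fderiv ℝ (fun u => α u b) (χ y) := by
      rw [mvfderiv, mfderiv_eq_fderiv]
      rfl
    rw [h3, ((hαd _ (χ.map_source hy)).hasFDerivAt.clm_apply (hasFDerivAt_const b _)).fderiv]
    simp only [ContinuousLinearMap.comp_zero, zero_add]
    rfl
  obtain ⟨ε, hε, hball⟩ := Metric.isOpen_iff.1 (isOpen_extChartAt_target (I := 𝓘(ℝ, E)) x) _
    (mem_extChartAt_target x)
  obtain ⟨f, hf⟩ := (convex_ball (χ x) ε).exists_forall_hasFDerivAt_of_fderiv_symmetric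
    Metric.isOpen_ball (fun u hu => (hαd u (hball hu)).differentiableWithinAt) (by
      intro u hu a b
      have hy : χ.symm u ∈ χ.source := χ.map_target (hball hu)
      have hs : ∀ a, ∀ᶠ z in 𝓝 (χ.symm u),
          ContMDiffAt 𝓘(ℝ, E) 𝓘(ℝ, E).tangent ∞ (T% (chartField x a)) z := fun a => by
        filter_upwards [(isOpen_extChartAt_source x).mem_nhds hy] with z hz
          using contMDiffAt_chartField hz a
      obtain ⟨X, hX, hXa⟩ := exists_isSmoothField_eventuallyEq (hs a)
      obtain ⟨Y, hY, hYb⟩ := exists_isSmoothField_eventuallyEq (hs b)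
      have hc := hcl X Y hX hY (χ.symm u)
      have e1 : (fun y => η y (Y y)) =ᶠ[𝓝 (χ.symm u)] h b := hYb.mono fun z hz => by
        simp only [hz, h]
      have e2 : (fun y => η y (X y)) =ᶠ[𝓝 (χ.symm u)] h a := hXa.mono fun z hz => by
        simp only [hz, h]
      rw [dirDeriv, dirDeriv, mvfderiv, mvfderiv, e1.mfderiv_eq, e2.mfderiv_eq,
        hXa.self_of_nhds, hYb.self_of_nhds,
        Filter.EventuallyEq.mlieBracket_vectorField_eq hXa hYb, mlieBracket_chartField hy,
        map_zero, sub_zero] at hc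
      have := sub_eq_zero.1 hc
      have k1 := hder _ hy a b
      have k2 := hder _ hy b a
      rw [χ.right_inv (hball hu)] at k1 k2
      rw [← k1, ← k2]
      exact this)
  refine ⟨Metric.ball (χ x) ε, f, Metric.isOpen_ball, Metric.mem_ball_self hε, hball, ?_, ?_⟩
  · rw [contDiffOn_infty_iff_fderiv_of_isOpen Metric.isOpen_ball]
    refine ⟨fun u hu => (hf u hu).differentiableAt.differentiableWithinAt, ?_⟩
    exact (hα.mono hball).congr fun u hu => (hf u hu).fderiv
  · intro y hy hyU w
    rw [(hf _ hyU).fderiv]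
    refine (hα_apply (χ y) _).trans ?_
    rw [χ.left_inv hy]
    exact congrArg (η y) (chartField_mfderiv hy w)

end Primitive

section FlatChart

variable {E : Type*} [NormedAddCommGroup E] [NormedSpace ℝ E] [FiniteDimensional ℝ E]
  {F : Type*} [NormedAddCommGroup F] [NormedSpace ℝ F] [FiniteDimensional ℝ F]
  {M : Type*} [TopologicalSpace M] [ChartedSpace E M]

/-- A non-zero linear form is the first component of a linear isomorphism onto a product. -/
theorem exists_continuousLinearEquiv_fst_eq (hEF : Module.finrank ℝ E = Module.finrank ℝ F + 1)
    {ℓ : E →L[ℝ] ℝ} {e : E} (he : ℓ e = 1) : ∃ A : E ≃L[ℝ] ℝ × F, ∀ v, (A v).1 = ℓ v := by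
  have hsurj : Function.Surjective (ℓ : E →ₗ[ℝ] ℝ) := fun t => ⟨t • e, by simp [he]⟩
  have hker : Module.finrank ℝ (LinearMap.ker (ℓ : E →ₗ[ℝ] ℝ)) = Module.finrank ℝ F := by
    have h := (ℓ : E →ₗ[ℝ] ℝ).finrank_range_add_finrank_ker
    rw [LinearMap.range_eq_top.2 hsurj, finrank_top, Module.finrank_self, hEF] at h
    omega
  let κ := LinearEquiv.ofFinrankEq _ _ hker
  let pr : E →ₗ[ℝ] LinearMap.ker (ℓ : E →ₗ[ℝ] ℝ) :=
    (LinearMap.id - (ℓ : E →ₗ[ℝ] ℝ).smulRight e).codRestrict _ fun v => by simp [he]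
  let A : E →ₗ[ℝ] ℝ × F := (ℓ : E →ₗ[ℝ] ℝ).prod (κ.toLinearMap.comp pr)
  have hA : Function.Injective A := by
    refine (injective_iff_map_eq_zero A).2 fun v hv => ?_
    have h1 : ℓ v = 0 := congrArg Prod.fst hv
    have h2 : κ (pr v) = 0 := congrArg Prod.snd hv
    have h3 : (pr v : E) = 0 := by rw [κ.map_eq_zero_iff.1 h2]; rfl
    have h4 : (pr v : E) = v - ℓ v • e := rfl
    rw [h4, h1, zero_smul, sub_zero] at h3
    exact h3
  have hd : Module.finrank ℝ E = Module.finrank ℝ (ℝ × F) := by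
    rw [hEF, Module.finrank_prod, Module.finrank_self, add_comm]
  exact ⟨(A.linearEquivOfInjective hA hd).toContinuousLinearEquiv, fun v => rfl⟩

/-- A chart whose first coordinate is a primitive of `η`. -/
structure IsFlatChart (η : RoughForm 𝓘(ℝ, E) M) (ψ : OpenPartialHomeomorph M (ℝ × F)) : Prop where
  smooth : ContMDiffOn 𝓘(ℝ, E) 𝓘(ℝ, ℝ × F) ∞ ψ ψ.source
  smooth_symm : ContMDiffOn 𝓘(ℝ, ℝ × F) 𝓘(ℝ, E) ∞ ψ.symm ψ.target
  mvfderiv_fst : ∀ z ∈ ψ.source, ∀ w : TangentSpace 𝓘(ℝ, E) z,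
    mvfderiv 𝓘(ℝ, E) (fun y => (ψ y).1) z w = η z w

variable [IsManifold 𝓘(ℝ, E) ∞ M] [T2Space M]

/-- A closed nowhere vanishing one-form is flat. -/
theorem exists_isFlatChart (hEF : Module.finrank ℝ E = Module.finrank ℝ F + 1)
    {η : RoughForm 𝓘(ℝ, E) M} (hη : IsSmoothForm 𝓘(ℝ, E) η)
    (hcl : IsClosedOneForm 𝓘(ℝ, E) η) {x : M} {ξ : TangentSpace 𝓘(ℝ, E) x} (hξ : η x ξ = 1) :
    ∃ ψ : OpenPartialHomeomorph M (ℝ × F), x ∈ ψ.source ∧ IsFlatChart η ψ := by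
  have : CompleteSpace E := FiniteDimensional.complete ℝ E
  obtain ⟨U, f, hU, hxU, hUt, hf, hfη⟩ := exists_primitive hη hcl x
  have hfx := hfη x (mem_extChartAt_source x) hxU ξ
  rw [hξ] at hfx
  obtain ⟨A, hA⟩ := exists_continuousLinearEquiv_fst_eq (F := F) hEF hfx
  let P : E →L[ℝ] F := (ContinuousLinearMap.snd ℝ ℝ F).comp (A : E →L[ℝ] ℝ × F)
  have hΨ : ContDiffOn ℝ ∞ (fun u => (f u, P u)) U := hf.prodMk P.contDiff.contDiffOn
  have hfd : HasFDerivAt f (fderiv ℝ f (extChartAt 𝓘(ℝ, E) x x)) (extChartAt 𝓘(ℝ, E) x x) :=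
    ((hf.contDiffAt (hU.mem_nhds hxU)).differentiableAt (by simp)).hasFDerivAt
  have hder : HasFDerivAt (fun u => (f u, P u)) (A : E →L[ℝ] ℝ × F) (extChartAt 𝓘(ℝ, E) x x) := by
    refine (hfd.prodMk P.hasFDerivAt).congr_fderiv ?_
    ext v
    · exact (hA v).symm
    · rfl
  obtain ⟨e, hxe, heU, hef, hesymm⟩ := exists_openPartialHomeomorph_of_hasFDerivAt_equiv hU hxU
    hΨ hder
  let c := chartAt E x
  have hsrc : ∀ z ∈ (c.trans e).source, z ∈ c.source ∧ c z ∈ e.source := fun z hz => by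
    simpa using hz
  have htgt : ∀ z ∈ (c.trans e).target, z ∈ e.target ∧ e.symm z ∈ c.target := fun z hz => by
    simpa using hz
  have hcs : ∀ z ∈ c.source, ContMDiffAt 𝓘(ℝ, E) 𝓘(ℝ, E) ∞ c z := fun z hz =>
    (contMDiffOn_chart (I := 𝓘(ℝ, E))).contMDiffAt (c.open_source.mem_nhds hz)
  refine ⟨c.trans e, by simpa using ⟨mem_chart_source E x, hxe⟩, ?_, ?_, ?_⟩
  · intro z hz
    obtain ⟨h1, h2⟩ := hsrc z hz
    have h3 : ContMDiffAt 𝓘(ℝ, E) 𝓘(ℝ, ℝ × F) ∞ e (c z) := by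
      have : (e : E → ℝ × F) = fun u => (f u, P u) := funext hef
      rw [this]
      exact (hΨ.contDiffAt (hU.mem_nhds (heU h2))).contMDiffAt
    exact (h3.comp z (hcs z h1)).contMDiffWithinAt
  · intro z hz
    obtain ⟨h1, h2⟩ := htgt z hz
    have h3 : ContMDiffAt 𝓘(ℝ, E) 𝓘(ℝ, E) ∞ c.symm (e.symm z) :=
      (contMDiffOn_chart_symm (I := 𝓘(ℝ, E))).contMDiffAt (c.open_target.mem_nhds h2)
    have h4 : ContMDiffAt 𝓘(ℝ, ℝ × F) 𝓘(ℝ, E) ∞ e.symm z :=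
      (hesymm.contDiffAt (e.open_target.mem_nhds h1)).contMDiffAt
    exact (h3.comp z h4).contMDiffWithinAt
  · intro z hz w
    obtain ⟨h1, h2⟩ := hsrc z hz
    have hfz : DifferentiableAt ℝ f (c z) :=
      (hf.contDiffAt (hU.mem_nhds (heU h2))).differentiableAt (by simp)
    have h3 : (fun y => ((c.trans e) y).1) = f ∘ c := funext fun y => by
      rw [OpenPartialHomeomorph.trans_apply, hef, Function.comp_apply]
    rw [h3, mvfderiv_comp_apply z hfz.mdifferentiableAt ((hcs z h1).mdifferentiableAt (by simp)),
      ← hfη z (by simpa using h1) (heU h2) w, mvfderiv, mfderiv_eq_fderiv]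
    rfl

end FlatChart

section LocallyConstant

variable {E' : Type*} [NormedAddCommGroup E'] [NormedSpace ℝ E']
  {H' : Type*} [TopologicalSpace H'] {I' : ModelWithCorners ℝ E' H'} [I'.Boundaryless]
  {N : Type*} [TopologicalSpace N] [ChartedSpace H' N] [IsManifold I' ∞ N]

/-- A function with vanishing derivative is locally constant. -/
theorem eventually_eq_of_mvfderiv_eq_zero {f : N → ℝ} {p : N}
    (hf : ∀ᶠ q in 𝓝 p, MDiffAt f q ∧ ∀ v, mvfderiv I' f q v = 0) : ∀ᶠ q in 𝓝 p, f q = f p := by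
  have htend : Filter.Tendsto (extChartAt I' p).symm (𝓝 (extChartAt I' p p)) (𝓝 p) := by
    simpa using (continuousAt_extChartAt_symm (I := I') p).tendsto
  obtain ⟨ε, hε, hball⟩ := Metric.eventually_nhds_iff_ball.1
    ((htend.eventually hf).and (extChartAt_target_mem_nhds (I := I') p))
  have hsymm : ∀ u ∈ Metric.ball (extChartAt I' p p) ε,
      MDifferentiableAt 𝓘(ℝ, E') I' (extChartAt I' p).symm u := fun u hu =>
    ((contMDiffOn_extChartAt_symm (n := 1) p).contMDiffAt
      ((isOpen_extChartAt_target p).mem_nhds (hball u hu).2)).mdifferentiableAt (by simp)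
  have hd : ∀ u ∈ Metric.ball (extChartAt I' p p) ε,
      DifferentiableAt ℝ (f ∘ (extChartAt I' p).symm) u := fun u hu =>
    (MDifferentiableAt.comp u (hball u hu).1.1 (hsymm u hu)).differentiableAt
  have h0 : ∀ u ∈ Metric.ball (extChartAt I' p p) ε,
      fderiv ℝ (f ∘ (extChartAt I' p).symm) u = 0 := by
    intro u hu
    rw [← mfderiv_eq_fderiv]
    ext v
    exact (mvfderiv_comp_apply u (hball u hu).1.1 (hsymm u hu) v).trans ((hball u hu).1.2 _)
  have hconst : ∀ {u w}, u ∈ Metric.ball (extChartAt I' p p) ε →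
      w ∈ Metric.ball (extChartAt I' p p) ε → (f ∘ (extChartAt I' p).symm) u = (f ∘ (extChartAt I' p).symm) w :=
    (convex_ball (extChartAt I' p p) ε).is_const_of_fderivWithin_eq_zero (𝕜 := ℝ)
    (fun u hu => (hd u hu).differentiableWithinAt) (fun u hu => by
      rw [fderivWithin_of_isOpen Metric.isOpen_ball hu, h0 u hu])
  filter_upwards [(continuousAt_extChartAt (I := I') p).preimage_mem_nhds
    (Metric.ball_mem_nhds _ hε), extChartAt_source_mem_nhds (I := I') p] with q hq hqs
  have h := hconst hq (Metric.mem_ball_self hε)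
  rwa [Function.comp_apply, Function.comp_apply, (extChartAt I' p).left_inv hqs,
    extChartAt_to_inv] at h

end LocallyConstant

section LeafManifold

variable {E : Type*} [NormedAddCommGroup E] [NormedSpace ℝ E]
  {F : Type*} [NormedAddCommGroup F] [NormedSpace ℝ F]
  {M : Type u} [TopologicalSpace M] [ChartedSpace E M]
  {η : RoughForm 𝓘(ℝ, E) M} {ψ : OpenPartialHomeomorph M (ℝ × F)}

theorem IsFlatChart.contMDiffAt (hψ : IsFlatChart η ψ) {z : M} (hz : z ∈ ψ.source) :
    ContMDiffAt 𝓘(ℝ, E) 𝓘(ℝ, ℝ × F) ∞ ψ z :=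
  hψ.smooth.contMDiffAt (ψ.open_source.mem_nhds hz)

theorem IsFlatChart.mdifferentiableAt_fst (hψ : IsFlatChart η ψ) {z : M} (hz : z ∈ ψ.source) :
    MDifferentiableAt 𝓘(ℝ, E) 𝓘(ℝ) (fun y => (ψ y).1) z :=
  (ContinuousLinearMap.fst ℝ ℝ F).mdifferentiableAt.comp z
    ((hψ.contMDiffAt hz).mdifferentiableAt (by simp))

section Tangent

variable {E' : Type*} [NormedAddCommGroup E'] [NormedSpace ℝ E']
  {H' : Type*} [TopologicalSpace H'] {I' : ModelWithCorners ℝ E' H'}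
  {N : Type*} [TopologicalSpace N] [ChartedSpace H' N]

theorem IsFlatChart.mvfderiv_fst_comp (hψ : IsFlatChart η ψ) {h : N → M} {p : N}
    (hp : h p ∈ ψ.source) (hh : MDifferentiableAt I' 𝓘(ℝ, E) h p) (v : TangentSpace I' p) :
    mvfderiv I' (fun q => (ψ (h q)).1) p v = η (h p) (mfderiv I' 𝓘(ℝ, E) h p v) :=
  (mvfderiv_comp_apply p (hψ.mdifferentiableAt_fst hp) hh v).trans (hψ.mvfderiv_fst _ hp _)

/-- Maps tangent to the kernel of `η` stay in the plaques of flat charts. -/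
theorem IsFlatChart.eventually_fst_eq [I'.Boundaryless] [IsManifold I' ∞ N]
    (hψ : IsFlatChart η ψ) {h : N → M} {p : N}
    (hp : h p ∈ ψ.source) (hh : ∀ᶠ q in 𝓝 p, MDifferentiableAt I' 𝓘(ℝ, E) h q)
    (hη : ∀ᶠ q in 𝓝 p, ∀ v, η (h q) (mfderiv I' 𝓘(ℝ, E) h q v) = 0) :
    ∀ᶠ q in 𝓝 p, h q ∈ ψ.source ∧ (ψ (h q)).1 = (ψ (h p)).1 := by
  have hs : ∀ᶠ q in 𝓝 p, h q ∈ ψ.source :=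
    hh.self_of_nhds.continuousAt.preimage_mem_nhds (ψ.open_source.mem_nhds hp)
  refine hs.and (eventually_eq_of_mvfderiv_eq_zero (I' := I') (f := fun q => (ψ (h q)).1) ?_)
  filter_upwards [hs, hh, hη] with q h1 h2 h3
  refine ⟨(hψ.mdifferentiableAt_fst h1).comp q h2, fun v => ?_⟩
  rw [hψ.mvfderiv_fst_comp h1 h2, h3]

end Tangent

/-- The chart of a plaque of a flat chart. -/
def plaqueChart (ψ : OpenPartialHomeomorph M (ℝ × F)) (c : ℝ) : PartialEquiv M F where
  toFun z := (ψ z).2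
  invFun u := ψ.symm (c, u)
  source := {z | z ∈ ψ.source ∧ (ψ z).1 = c}
  target := {u | (c, u) ∈ ψ.target}
  map_source' := by
    rintro z ⟨hz, rfl⟩
    exact ψ.map_source hz
  map_target' u hu := ⟨ψ.map_target hu, by rw [ψ.right_inv hu]⟩
  left_inv' := by
    rintro z ⟨hz, rfl⟩
    exact ψ.left_inv hz
  right_inv' u hu := by rw [ψ.right_inv hu]

omit [NormedSpace ℝ F] in
theorem isOpen_target_plaqueChart (ψ : OpenPartialHomeomorph M (ℝ × F)) (c : ℝ) :
    IsOpen (plaqueChart ψ c).target :=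
  ψ.open_target.preimage (Continuous.prodMk_right c)

theorem IsFlatChart.contMDiffAt_symm_plaqueChart (hψ : IsFlatChart η ψ) {c : ℝ} {u : F}
    (hu : u ∈ (plaqueChart ψ c).target) :
    ContMDiffAt 𝓘(ℝ, F) 𝓘(ℝ, E) ∞ (plaqueChart ψ c).symm u := by
  have h1 : ContMDiffAt 𝓘(ℝ, F) 𝓘(ℝ, ℝ × F) ∞ (fun u : F => (c, u)) u :=
    (contDiff_prodMk_right c).contMDiff.contMDiffAt
  exact (hψ.smooth_symm.contMDiffAt (ψ.open_target.mem_nhds hu)).comp u h1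

theorem IsFlatChart.η_mfderiv_symm_plaqueChart (hψ : IsFlatChart η ψ) {c : ℝ} {u : F}
    (hu : u ∈ (plaqueChart ψ c).target) (v : TangentSpace 𝓘(ℝ, F) u) :
    η ((plaqueChart ψ c).symm u) (mfderiv 𝓘(ℝ, F) 𝓘(ℝ, E) (plaqueChart ψ c).symm u v) = 0 := by
  have h := hψ.mvfderiv_fst_comp ((plaqueChart ψ c).map_target hu).1
    ((hψ.contMDiffAt_symm_plaqueChart hu).mdifferentiableAt (by simp)) v
  rw [← h]
  have hev : (fun q => (ψ ((plaqueChart ψ c).symm q)).1) =ᶠ[𝓝 u] fun _ => c := by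
    filter_upwards [(isOpen_target_plaqueChart ψ c).mem_nhds hu] with q hq
    exact ((plaqueChart ψ c).map_target hq).2
  have h2 := hev.mfderiv_eq (I := 𝓘(ℝ, F)) (I' := 𝓘(ℝ))
  rw [mfderiv_const] at h2
  exact congrArg (fun T => T v) h2

theorem IsFlatChart.isOpen_source_trans {ψ' : OpenPartialHomeomorph M (ℝ × F)}
    (hψ : IsFlatChart η ψ) (hψ' : IsFlatChart η ψ') (c c' : ℝ) :
    IsOpen ((plaqueChart ψ c).symm.trans (plaqueChart ψ' c')).source := by
  refine isOpen_iff_mem_nhds.2 ?_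
  rintro u ⟨hu, hu', rfl⟩
  have hnhds := (isOpen_target_plaqueChart ψ c).mem_nhds hu
  have h := hψ'.eventually_fst_eq (I' := 𝓘(ℝ, F)) hu'
    (Filter.eventually_of_mem hnhds fun q hq =>
      (hψ.contMDiffAt_symm_plaqueChart hq).mdifferentiableAt (by simp))
    (Filter.eventually_of_mem hnhds fun q hq => hψ.η_mfderiv_symm_plaqueChart hq)
  filter_upwards [hnhds, h] with q h1 h2
  exact ⟨h1, h2⟩

theorem IsFlatChart.contDiffOn_trans {ψ' : OpenPartialHomeomorph M (ℝ × F)}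
    (hψ : IsFlatChart η ψ) (hψ' : IsFlatChart η ψ') (c c' : ℝ) :
    ContDiffOn ℝ ∞ ((plaqueChart ψ c).symm.trans (plaqueChart ψ' c'))
      ((plaqueChart ψ c).symm.trans (plaqueChart ψ' c')).source := by
  rintro u ⟨hu, hu', -⟩
  refine ContDiffAt.contDiffWithinAt ?_
  rw [← contMDiffAt_iff_contDiffAt]
  exact (ContinuousLinearMap.snd ℝ ℝ F).contMDiff.contMDiffAt.comp u
    ((hψ'.contMDiffAt hu').comp u (hψ.contMDiffAt_symm_plaqueChart hu))

/-- A charted space defined by charts with smooth transitions is a manifold. -/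
theorem isManifold_chartedSpaceCore {X : Type*} (c : ChartedSpaceCore F X)
    (h : ∀ e ∈ c.atlas, ∀ e' ∈ c.atlas, ContDiffOn ℝ ∞ (e.symm.trans e') (e.symm.trans e').source) :
    letI := c.toTopologicalSpace
    letI := c.toChartedSpace
    IsManifold 𝓘(ℝ, F) ∞ X := by
  let := c.toTopologicalSpace
  let := c.toChartedSpace
  refine isManifold_of_contDiffOn 𝓘(ℝ, F) ∞ X fun e e' he he' => ?_
  obtain ⟨_, ⟨e₀, rfl⟩, _, ⟨he₀, rfl⟩, rfl⟩ := he
  obtain ⟨_, ⟨e₁, rfl⟩, _, ⟨he₁, rfl⟩, rfl⟩ := he'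
  have h1 := h e₀ he₀ e₁ he₁
  rw [modelWithCornersSelf_coe, Set.range_id, Set.inter_univ]
  exact h1

/-- `i : N → M` is a bijective immersion of a manifold whose charts are the plaques of flat
charts. -/
structure IsLeafManifold (F : Type*) [NormedAddCommGroup F] [NormedSpace ℝ F]
    {N : Type*} [TopologicalSpace N] [ChartedSpace F N]
    (η : RoughForm 𝓘(ℝ, E) M) (i : N → M) : Prop where
  injective : Function.Injective i
  surjective : Function.Surjective i
  chart : ∀ p : N, ∃ ψ : OpenPartialHomeomorph M (ℝ × F), IsFlatChart η ψ ∧ i p ∈ ψ.source ∧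
    (∀ q, q ∈ (chartAt F p).source ↔ i q ∈ ψ.source ∧ (ψ (i q)).1 = (ψ (i p)).1) ∧
    ∀ q, chartAt F p q = (ψ (i q)).2

theorem isLeafManifold_chartedSpaceCore {N : Type*} (c : ChartedSpaceCore F N) {i : N → M}
    (hi : Function.Bijective i)
    (h : ∀ p : N, ∃ ψ : OpenPartialHomeomorph M (ℝ × F), IsFlatChart η ψ ∧ i p ∈ ψ.source ∧
      (∀ q, q ∈ (c.chartAt p).source ↔ i q ∈ ψ.source ∧ (ψ (i q)).1 = (ψ (i p)).1) ∧
      ∀ q, c.chartAt p q = (ψ (i q)).2) :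
    letI := c.toTopologicalSpace
    letI := c.toChartedSpace
    IsLeafManifold F η i := by
  let := c.toTopologicalSpace
  let := c.toChartedSpace
  exact ⟨hi.1, hi.2, h⟩

/-- The foliation defined by a closed one-form has a leaf topology. -/
theorem exists_isLeafManifold
    (h : ∀ x : M, ∃ ψ : OpenPartialHomeomorph M (ℝ × F), x ∈ ψ.source ∧ IsFlatChart η ψ) :
    ∃ (N : Type u) (_ : TopologicalSpace N) (_ : ChartedSpace F N)
      (_ : IsManifold 𝓘(ℝ, F) ∞ N) (i : N → M), IsLeafManifold F η i := by
  choose ψ hx hψ using h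
  let core : ChartedSpaceCore F M :=
    { atlas := Set.range fun x => plaqueChart (ψ x) (ψ x x).1
      chartAt := fun x => plaqueChart (ψ x) (ψ x x).1
      mem_chart_source := fun x => ⟨hx x, rfl⟩
      chart_mem_atlas := fun x => ⟨x, rfl⟩
      open_source := by
        rintro _ _ ⟨x, rfl⟩ ⟨y, rfl⟩
        exact (hψ x).isOpen_source_trans (hψ y) _ _
      continuousOn_toFun := by
        rintro _ _ ⟨x, rfl⟩ ⟨y, rfl⟩
        exact ((hψ x).contDiffOn_trans (hψ y) _ _).continuousOn }
  have hcore := isManifold_chartedSpaceCore core (by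
    rintro _ ⟨x, rfl⟩ _ ⟨y, rfl⟩
    exact (hψ x).contDiffOn_trans (hψ y) _ _)
  exact ⟨M, core.toTopologicalSpace, core.toChartedSpace, hcore, id,
    isLeafManifold_chartedSpaceCore core Function.bijective_id
      fun x => ⟨ψ x, hψ x, hx x, fun q => Iff.rfl, fun q => rfl⟩⟩

end LeafManifold

section LeafManifold

variable {E : Type*} [NormedAddCommGroup E] [NormedSpace ℝ E]
  {F : Type*} [NormedAddCommGroup F] [NormedSpace ℝ F]
  {M : Type u} [TopologicalSpace M] [ChartedSpace E M]
  {N : Type*} [TopologicalSpace N] [ChartedSpace F N]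
  {η : RoughForm 𝓘(ℝ, E) M} {i : N → M}

theorem IsLeafManifold.contMDiff [IsManifold 𝓘(ℝ, F) ∞ N] (hi : IsLeafManifold F η i) :
    ContMDiff 𝓘(ℝ, F) 𝓘(ℝ, E) ∞ i := by
  intro p
  obtain ⟨ψ, hψ, hp, hsrc, hψi⟩ := hi.chart p
  have hc : ContMDiffAt 𝓘(ℝ, F) 𝓘(ℝ, F) ∞ (chartAt F p) p :=
    contMDiffOn_chart.contMDiffAt ((chartAt F p).open_source.mem_nhds (mem_chart_source F p))
  have ht : chartAt F p p ∈ (plaqueChart ψ (ψ (i p)).1).target := by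
    rw [hψi]
    exact ψ.map_source hp
  refine ((hψ.contMDiffAt_symm_plaqueChart ht).comp p hc).congr_of_eventuallyEq ?_
  filter_upwards [(chartAt F p).open_source.mem_nhds (mem_chart_source F p)] with q hq
  rw [Function.comp_apply, hψi]
  exact ((plaqueChart ψ (ψ (i p)).1).left_inv ((hsrc q).1 hq)).symm

theorem IsLeafManifold.η_mfderiv [IsManifold 𝓘(ℝ, F) ∞ N] (hi : IsLeafManifold F η i) (p : N)
    (v : TangentSpace 𝓘(ℝ, F) p) : η (i p) (mfderiv 𝓘(ℝ, F) 𝓘(ℝ, E) i p v) = 0 := by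
  obtain ⟨ψ, hψ, hp, hsrc, -⟩ := hi.chart p
  rw [← hψ.mvfderiv_fst_comp hp ((hi.contMDiff p).mdifferentiableAt (by simp))]
  have hev : (fun q => (ψ (i q)).1) =ᶠ[𝓝 p] fun _ => (ψ (i p)).1 := by
    filter_upwards [(chartAt F p).open_source.mem_nhds (mem_chart_source F p)] with q hq
      using ((hsrc q).1 hq).2
  have h2 := hev.mfderiv_eq (I := 𝓘(ℝ, F)) (I' := 𝓘(ℝ))
  rw [mfderiv_const] at h2
  exact congrArg (fun T => T v) h2

theorem IsLeafManifold.injective_mfderiv [IsManifold 𝓘(ℝ, F) ∞ N] (hi : IsLeafManifold F η i)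
    (p : N) : Function.Injective (mfderiv 𝓘(ℝ, F) 𝓘(ℝ, E) i p) := by
  obtain ⟨ψ, hψ, hp, -, hψi⟩ := hi.chart p
  have hχ : (extChartAt 𝓘(ℝ, F) p : N → F) = (fun z => (ψ z).2) ∘ i := funext fun q => by
    rw [Function.comp_apply, ← hψi]
    simp
  have h1 : MDifferentiableAt 𝓘(ℝ, E) 𝓘(ℝ, F) (fun z => (ψ z).2) (i p) :=
    (ContinuousLinearMap.snd ℝ ℝ F).mdifferentiableAt.comp (i p)
      ((hψ.contMDiffAt hp).mdifferentiableAt (by simp))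
  have h2 := mfderiv_comp p h1 ((hi.contMDiff p).mdifferentiableAt (by simp))
  rw [← hχ] at h2
  intro v w hvw
  refine (isInvertible_mfderiv_extChartAt (I := 𝓘(ℝ, F)) (mem_extChartAt_source p)).injective ?_
  rw [h2]
  exact congrArg (mfderiv 𝓘(ℝ, E) 𝓘(ℝ, F) (fun z => (ψ z).2) (i p)) hvw

/-- Smooth maps tangent to the foliation are continuous for the leaf topology. -/
theorem IsLeafManifold.continuous_of_comp (hi : IsLeafManifold F η i)
    {E' : Type*} [NormedAddCommGroup E'] [NormedSpace ℝ E']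
    {H' : Type*} [TopologicalSpace H'] {I' : ModelWithCorners ℝ E' H'} [I'.Boundaryless]
    {L : Type*} [TopologicalSpace L] [ChartedSpace H' L] [IsManifold I' ∞ L] {j : L → N}
    (hj : MDifferentiable I' 𝓘(ℝ, E) (i ∘ j))
    (hη : ∀ q v, η (i (j q)) (mfderiv I' 𝓘(ℝ, E) (i ∘ j) q v) = 0) : Continuous j := by
  refine continuous_iff_continuousAt.2 fun p => ?_
  obtain ⟨ψ, hψ, hp, hsrc, hψi⟩ := hi.chart (j p)
  have h := hψ.eventually_fst_eq (I' := I') (h := i ∘ j) hp (Filter.Eventually.of_forall hj)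
    (Filter.Eventually.of_forall hη)
  refine ((chartAt F (j p)).continuousAt_iff_continuousAt_comp_left
    (h.mono fun q hq => (hsrc _).2 hq)).2 ?_
  have h2 : (chartAt F (j p) ∘ j) = fun q => (ψ ((i ∘ j) q)).2 := funext fun q => hψi _
  rw [h2]
  exact continuous_snd.continuousAt.comp
    (ContinuousAt.comp (f := i ∘ j) (x := p) (ψ.continuousAt hp) (hj p).continuousAt)

theorem exists_apply_eq_of_injective [FiniteDimensional ℝ E] [FiniteDimensional ℝ F]
    (hEF : Module.finrank ℝ E = Module.finrank ℝ F + 1) {ℓ : E →L[ℝ] ℝ} {e : E} (he : ℓ e = 1)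
    {A : F →L[ℝ] E} (hA : Function.Injective A) (hℓA : ∀ v, ℓ (A v) = 0) {w : E}
    (hw : ℓ w = 0) : ∃ v, A v = w := by
  have hsurj : Function.Surjective (ℓ : E →ₗ[ℝ] ℝ) := fun t => ⟨t • e, by simp [he]⟩
  have hle : LinearMap.range (A : F →ₗ[ℝ] E) ≤ LinearMap.ker (ℓ : E →ₗ[ℝ] ℝ) := by
    rintro _ ⟨v, rfl⟩
    exact hℓA v
  have h := (ℓ : E →ₗ[ℝ] ℝ).finrank_range_add_finrank_ker
  rw [LinearMap.range_eq_top.2 hsurj, finrank_top, Module.finrank_self, hEF] at h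
  have heq := Submodule.eq_of_le_of_finrank_eq hle (by
    rw [LinearMap.finrank_range_of_inj hA]
    omega)
  have hmem : w ∈ LinearMap.ker (ℓ : E →ₗ[ℝ] ℝ) := hw
  rw [← heq] at hmem
  exact hmem

theorem injective_mfderiv_subtype_val [IsManifold 𝓘(ℝ, F) ∞ N] (U : TopologicalSpace.Opens N)
    (p : U) : Function.Injective (mfderiv 𝓘(ℝ, F) 𝓘(ℝ, F) (Subtype.val : U → N) p) := by
  classical
  let r : N → U := fun q => if hq : q ∈ U then ⟨q, hq⟩ else p
  have hr : ∀ q : U, r q = q := fun q => dif_pos q.2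
  have hr1 : ContMDiffAt 𝓘(ℝ, F) 𝓘(ℝ, F) ∞ r p := by
    rw [← ContMDiffAt.subtypeVal_comp_iff]
    refine contMDiffAt_id.congr_of_eventuallyEq ?_
    filter_upwards [U.isOpen.mem_nhds p.2] with q hq
    exact congrArg Subtype.val (hr ⟨q, hq⟩)
  have h := mfderiv_comp p (hr1.mdifferentiableAt (by simp))
    ((contMDiff_subtype_val (n := 1) p).mdifferentiableAt (by simp))
  have hid : r ∘ (Subtype.val : U → N) = id := funext hr
  rw [hid, mfderiv_id] at h
  intro v w hvw
  have h1 := congrArg (fun T => T v) h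
  have h2 := congrArg (fun T => T w) h
  refine h1.trans (Eq.trans ?_ h2.symm)
  exact congrArg (mfderiv 𝓘(ℝ, F) 𝓘(ℝ, F) r p) hvw

end LeafManifold

section Leaf

variable {n : ℕ} {M : Type u} [TopologicalSpace M] [T2Space M]
  [ChartedSpace (EuclideanSpace ℝ (Fin (n + 1))) M] [IsManifold (𝓡 (n + 1)) ∞ M]

/-- A leaf of a closed nowhere vanishing one-form passes through every point. -/
theorem exists_isLeaf {η : RoughForm (𝓡 (n + 1)) M} (hη : IsSmoothForm (𝓡 (n + 1)) η)
    (hcl : IsClosedOneForm (𝓡 (n + 1)) η)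
    (hne : ∀ x, ∃ v : TangentSpace (𝓡 (n + 1)) x, η x v = 1) (x : M) :
    ∃ (L : Type u) (_ : TopologicalSpace L) (_ : ChartedSpace (EuclideanSpace ℝ (Fin n)) L)
      (_ : IsManifold (𝓡 n) ∞ L) (i : L → M), IsLeaf n η i ∧ x ∈ Set.range i := by
  have hdim : Module.finrank ℝ (EuclideanSpace ℝ (Fin (n + 1)))
      = Module.finrank ℝ (EuclideanSpace ℝ (Fin n)) + 1 := by simp
  obtain ⟨N, _, _, _, i, hi⟩ := exists_isLeafManifold (η := η)
    (F := EuclideanSpace ℝ (Fin n)) fun x => exists_isFlatChart hdim hη hcl (hne x).choose_spec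
  obtain ⟨p, rfl⟩ := hi.surjective x
  have : LocallyConnectedSpace N := ChartedSpace.locallyConnectedSpace (EuclideanSpace ℝ (Fin n)) N
  let U : TopologicalSpace.Opens N := ⟨connectedComponent p, isOpen_connectedComponent⟩
  have hval : ∀ q : U, MDifferentiableAt (𝓡 n) (𝓡 n) (Subtype.val : U → N) q := fun q =>
    (contMDiff_subtype_val (n := 1) q).mdifferentiableAt (by simp)
  have hder : ∀ (q : U) v, mfderiv (𝓡 n) (𝓡 (n + 1)) (i ∘ Subtype.val) q v
      = mfderiv (𝓡 n) (𝓡 (n + 1)) i q (mfderiv (𝓡 n) (𝓡 n) (Subtype.val : U → N) q v) := fun q v =>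
    mfderiv_comp_apply q ((hi.contMDiff q).mdifferentiableAt (by simp)) (hval q) v
  have hinj : ∀ q : U, Function.Injective (mfderiv (𝓡 n) (𝓡 (n + 1)) (i ∘ Subtype.val) q) := by
    intro q v w hvw
    rw [hder, hder] at hvw
    exact injective_mfderiv_subtype_val U q (hi.injective_mfderiv q hvw)
  have hηd : ∀ (q : U) v, η (i q) (mfderiv (𝓡 n) (𝓡 (n + 1)) (i ∘ Subtype.val) q v) = 0 := by
    intro q v
    rw [hder]
    exact hi.η_mfderiv q _
  refine ⟨U, inferInstance, inferInstance, inferInstance, i ∘ Subtype.val, ⟨⟨?_, ?_, ?_, hinj, ?_⟩,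
    ?_⟩, ⟨p, mem_connectedComponent⟩, rfl⟩
  · exact Subtype.connectedSpace isConnected_connectedComponent
  · exact hi.contMDiff.comp contMDiff_subtype_val
  · exact hi.injective.comp Subtype.val_injective
  · intro q w
    refine ⟨?_, fun hw => ?_⟩
    · rintro ⟨v, rfl⟩
      exact hηd q v
    · obtain ⟨e, he⟩ := hne (i q)
      exact exists_apply_eq_of_injective (E := EuclideanSpace ℝ (Fin (n + 1)))
        (F := EuclideanSpace ℝ (Fin n)) hdim he (hinj q) (hηd q) hw
  · intro L' _ _ _ i' hi' hsub
    choose j hj using fun q => hi.surjective (i' q)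
    obtain rfl : i ∘ j = i' := funext hj
    have hjc : Continuous j := hi.continuous_of_comp (I' := 𝓡 n)
      (fun q => (hi'.smooth q).mdifferentiableAt (by simp)) fun q v => hi'.η_mfderiv q v
    have := hi'.connected
    obtain ⟨q₀, hq₀⟩ := hsub ⟨⟨p, mem_connectedComponent⟩, rfl⟩
    have hp : p ∈ Set.range j := ⟨q₀, hi.injective hq₀⟩
    rintro _ ⟨q, rfl⟩
    exact ⟨⟨j q, (isPreconnected_range hjc).subset_connectedComponent hp ⟨q, rfl⟩⟩, rfl⟩

end Leaf

end CosymplecticStatistical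

theorem mainTheorem2 (n : ℕ) (M : Type u) [TopologicalSpace M] [T2Space M]
    [ChartedSpace (EuclideanSpace ℝ (Fin (2 * n + 1))) M] [IsManifold (𝓡 (2 * n + 1)) ∞ M]
    (S : CosymplecticStatistical.AlmostContactMetric (𝓡 (2 * n + 1)) M)
    (hS : S.IsAlmostCosymplectic)
    (D Dstar D₀ : CosymplecticStatistical.AffineConnection (𝓡 (2 * n + 1)) M)
    (hD : CosymplecticStatistical.IsStatistical S.g D Dstar)
    (hD₀ : CosymplecticStatistical.IsLeviCivita S.g D₀) :
    CosymplecticStatistical.HasKaehlerStatisticalLeaves S D Dstar ↔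
      ∀ X Y : CosymplecticStatistical.RoughField (𝓡 (2 * n + 1)) M,
        CosymplecticStatistical.IsSmoothField (𝓡 (2 * n + 1)) X →
        CosymplecticStatistical.IsSmoothField (𝓡 (2 * n + 1)) Y → ∀ x : M,
          D (fun y => S.φ y (Y y)) x (X x) - S.φ x (Dstar Y x (X x))
            = S.g.inner x (S.shape D₀ x (X x)) (S.φ x (Y x)) • S.ξ x
              + S.η x (Y x) • S.φ x (S.shape D₀ x (X x))
              + CosymplecticStatistical.differenceTensor D D₀ X (fun y => S.φ y (Y y)) x
              + S.φ x (CosymplecticStatistical.differenceTensor D D₀ X Y x) := by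
  refine ⟨fun h => ?_, fun h L _ _ _ i hi => hi.integral.isKaehlerStatisticalLeaf hS hD hD₀ h⟩
  refine CosymplecticStatistical.AlmostContactMetric.structureIdentity_of_isKaehlerStatisticalLeaf
    (l := 2 * n) hS hD hD₀ fun x => ?_
  obtain ⟨L, _, _, _, i, hi, hx⟩ := CosymplecticStatistical.exists_isLeaf S.smooth_η hS.closed_η
    (fun y => ⟨S.ξ y, S.η_ξ y⟩) x
  exact ⟨L, _, _, inferInstance, i, hi.integral, hx, h L i hi⟩
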